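/- Notation. For $|q|<1$ let $(a;q)_\infty=\prod_{k\ge0}(1-aq^k)$. Let $B_j$ be the Bernoulli numbers, let $\operatorname{Li}_0(z)=z/(1-z)$ and $\operatorname{Li}_{-n-1}(z)=z\,\frac{d}{dz}\operatorname{Li}_{-n}(z)$ for $n\ge 0$, and $\operatorname{Li}_2(z)=\sum_{n\ge1}z^n/n^2$ for $|z|<1$. Fix real $\theta,Y$ with $|\theta|<\pi/2$ and $0<Y<\pi|\cot\theta|$ (if $\theta=0$, only $Y>0$ is required). For $\beta\neq0$ with $\arg\beta=\theta$ put $$\mathcal C_\beta=\mathbb C\setminus\bigl(2\pi\mathrm i\,\mathbb Z+\beta\,\mathbb R_{\le0}\bigr).$$ The following branches exist. $\log(e^{-y};e^{-\beta})_\infty$ is the logarithm of $(e^{-y};e^{-\beta})_\infty$ that is analytic in $y\in\mathcal C_\beta$ and equals $\sum_{k\ge0}\log(1-e^{-y-\beta k})$ (principal logarithms) for $\operatorname{Re}y>0$. $\operatorname{Li}_2(e^{-y})$ and $\log(1-e^{-y})$ are the branches that are analytic in $y\in\mathcal C_\beta$ and real for $y>0$ (so that $\operatorname{Li}_2(e^{-y})=\sum_{n\ge1}e^{-ny}/n^2$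 for $\operatorname{Re}y>0$). $\log x$ and $\log\Gamma(x)$ are the branches that are analytic for $x\notin\mathbb R_{\le0}$ and real for $x>0$. With these branches, for every integer $N\ge0$ there is a constant $D=D(N,Y,\theta)$ such that, for all $\beta\neq0$ and $y$ with $$|\operatorname{Im}y|\le\pi,\qquad \operatorname{Re}y\ge-Y,\qquad y\notin\beta\,\mathbb R_{\le0},\qquad \arg\beta=\theta,$$ the difference between $\log(e^{-y};e^{-\beta})_\infty$ and $$-\frac{\operatorname{Li}_2(e^{-y})}{\beta}+\frac{\log(1-e^{-y})}{2}+\frac{\log 2\pi}{2}-\frac y\beta+\Bigl(\frac y\beta-\frac12\Bigr)\log\frac y\beta-\log\Gamma\Bigl(\frac y\beta\Bigr)-\sum_{k=1}^{N}\frac{B_{2k}\,\beta^{2k-1}}{(2k)!}\Bigl(\operatorname{Li}_{2-2k}(e^{-y})-\frac{(2k-2)!}{y^{2k-1}}\Bigr)$$ has absolute value at most $D|\beta|^{2N+1}$. In other words, the left-hand side has the corresponding infinite asymptotic expansion as $\beta\to0$, uniformly in $y$ in this region. -/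

import Mathlib

noncomputable section

namespace QPochAsymptotics

/-- The infinite `q`-Pochhammer symbol `(a; q)_∞ = ∏_{k ≥ 0} (1 - a q^k)`, for `|q| < 1`. -/
def qPoch (a q : ℂ) : ℂ := ∏' k : ℕ, (1 - a * q ^ k)

/-- The polylogarithm `Li_{-n}(z)` of non-positive integer order, as a rational function of `z`:
`Li_0(z) = z / (1 - z)` and `Li_{-(n+1)}(z) = z (d/dz) Li_{-n}(z)`. It has a pole only at `z = 1`,
and it is the continuation of `∑_{k ≥ 1} k^n z^k`. -/
def polylogNeg : ℕ → ℂ → ℂ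
  | 0 => fun z => z / (1 - z)
  | n + 1 => fun z => z * deriv (polylogNeg n) z

/-- The complex plane cut along the rays `2πin + β ℝ_{≤ 0}`, `n ∈ ℤ`. -/
def cutPlane (β : ℂ) : Set ℂ :=
  {y | ∀ (n : ℤ) (t : ℝ), t ≤ 0 → y ≠ 2 * (Real.pi : ℂ) * Complex.I * (n : ℂ) + β * (t : ℂ)}

/-- The branch of `log (1 - e^{-y})` on the cut plane that is real for `y > 0`. It vanishes as
`y → ∞` in the direction of `β`, and its derivative is `e^{-y} / (1 - e^{-y})`, so that it is
obtained by integrating the latter along the ray `y + β ℝ_{≥ 0}`, which avoids the cuts. -/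
def logOneSubExp (β y : ℂ) : ℂ :=
  -∫ s in Set.Ioi (0 : ℝ), β * polylogNeg 0 (Complex.exp (-(y + s * β)))

/-- The branch of `Li_2(e^{-y})` on the cut plane that is real for `y > 0`. Its second derivative
is `e^{-y} / (1 - e^{-y})`, which is integrated twice along the ray `y + β ℝ_{≥ 0}`. -/
def dilogExp (β y : ℂ) : ℂ :=
  ∫ s in Set.Ioi (0 : ℝ), β ^ 2 * (s : ℂ) * polylogNeg 0 (Complex.exp (-(y + s * β)))

/-- The branch of `log (e^{-y}; e^{-β})_∞` on the cut plane that vanishes as `y → ∞`: the sum of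
the branches of `log (1 - e^{-(y + kβ)})`. -/
def logQPoch (β y : ℂ) : ℂ := ∑' k : ℕ, logOneSubExp β (y + k * β)

/-- The branch of `log Γ` on `ℂ ∖ ℝ_{≤ 0}` that is real on the positive reals, by the logarithm of
the Weierstrass product (with principal logarithms). -/
def logGamma (x : ℂ) : ℂ :=
  -(Real.eulerMascheroniConstant : ℂ) * x - Complex.log x +
    ∑' n : ℕ, (x / ((n : ℂ) + 1) - Complex.log (1 + x / ((n : ℂ) + 1)))

/-- `F` is the branch of `log (1 - e^{-y})` that is analytic off the cuts and real for `y > 0`. -/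
structure IsLogOneSubExpBranch (β : ℂ) (F : ℂ → ℂ) : Prop where
  analytic : AnalyticOnNhd ℂ F (cutPlane β)
  exp_eq : ∀ y ∈ cutPlane β, Complex.exp (F y) = 1 - Complex.exp (-y)
  real : ∀ y : ℝ, 0 < y → (F y).im = 0

/-- `F` is the branch of `Li_2(e^{-y})` that is analytic off the cuts and given by the (real)
dilogarithm series for `y > 0`. -/
structure IsDilogExpBranch (β : ℂ) (F : ℂ → ℂ) : Prop where
  analytic : AnalyticOnNhd ℂ F (cutPlane β)
  hasSum : ∀ y : ℂ, 0 < y.re →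
    HasSum (fun n : ℕ => Complex.exp (-y) ^ (n + 1) / ((n : ℂ) + 1) ^ 2) (F y)
  real : ∀ y : ℝ, 0 < y → (F y).im = 0

/-- `F` is the branch of `log (e^{-y}; e^{-β})_∞` that is analytic off the cuts and equal to
`∑_{k ≥ 0} log (1 - e^{-y-βk})` (principal logarithms) for `Re y > 0`. -/
structure IsLogQPochBranch (β : ℂ) (F : ℂ → ℂ) : Prop where
  analytic : AnalyticOnNhd ℂ F (cutPlane β)
  exp_eq : ∀ y ∈ cutPlane β, Complex.exp (F y) = qPoch (Complex.exp (-y)) (Complex.exp (-β))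
  hasSum : ∀ y : ℂ, 0 < y.re →
    HasSum (fun k : ℕ => Complex.log (1 - Complex.exp (-y - β * k))) (F y)

/-- `F` is the branch of `log Γ` that is analytic off `ℝ_{≤ 0}` and real on the positive reals. -/
structure IsLogGammaBranch (F : ℂ → ℂ) : Prop where
  analytic : AnalyticOnNhd ℂ F Complex.slitPlane
  exp_eq : ∀ x ∈ Complex.slitPlane, Complex.exp (F x) = Complex.Gamma x
  real : ∀ x : ℝ, 0 < x → (F x).im = 0

/-- The asymptotic series, truncated at `k = N`. The principal `Complex.log (y / β)` is the branch
that is real for `y / β > 0` and analytic for `y ∉ β ℝ_{≤ 0}`. -/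
def truncatedSeries (N : ℕ) (β y : ℂ) : ℂ :=
  -dilogExp β y / β + logOneSubExp β y / 2 + (Real.log (2 * Real.pi) : ℂ) / 2 - y / β
    + (y / β - 1 / 2) * Complex.log (y / β) - logGamma (y / β)
    - ∑ k ∈ Finset.Icc 1 N,
        (bernoulli (2 * k) : ℂ) * β ^ (2 * k - 1) / ((2 * k).factorial : ℂ) *
          (polylogNeg (2 * k - 2) (Complex.exp (-y))
            - ((2 * k - 2).factorial : ℂ) / y ^ (2 * k - 1))

end QPochAsymptotics

end

noncomputable section

namespace QPochAsymptotics

open Filter Topology Set Complex MeasureTheory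

/-! The proof is an Euler–Maclaurin expansion of the sum of `log (1 - e^{-(y + kβ)})` over `k ≥ 0`,
after the singularity at `y = 0` has been removed. Put `f(s) = log (1 - e^{-(y + sβ)}) - log (y/β +
s)`. The derivatives of `f` are, up to powers of `β`, those of `1/(e^w - 1) - 1/w` at `w = y + sβ`,
which is holomorphic at `0`. The subtracted logarithms are restored exactly by `logGamma`, whose
functional equation `logGamma_add_one` matches `logQPoch_eq_add` under `y ↦ y + β`.

Let `r(y)` be the difference of the two sides. By these functional equations and
`integral_eq_eulerMaclaurin` on `[0, 1]`, `r(y) - r(y + β)` is only the Bernoulli remainder integral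
(`remainder_sub_remainder_add`). Stirling's formula and exponential decay give `r(y + nβ) → 0`
(`tendsto_remainder_ray`), so `r(y)` is the sum of these integrals.

Uniformity comes from `norm_polylogRegular_succ_le`: on a region containing all rays in question,
the derivatives of the regular kernel are `O(1/(1 + (Re w)^2))`. The bounds for the unit steps then
telescope as differences of `arctan`, with total at most `π` whatever `y` and `β` are. The bound on
`Y` keeps that region away from every nonzero point of `2πiℤ`.

The branches are integrals along `y + β ℝ_{≥ 0}`. Their derivatives, their decay, and the functional
identities all follow from the fundamental theorem of calculus on this ray. -/

/-! ### Polylogarithms of non-positive order -/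

theorem polylogNeg_eq_mul_eval (n : ℕ) : ∃ R : Polynomial ℂ, ∀ z : ℂ, z ≠ 1 →
    polylogNeg n z = z * R.eval (1 - z)⁻¹ := by
  induction n with
  | zero => exact ⟨Polynomial.X, fun z _ => by simp [polylogNeg, div_eq_mul_inv]⟩
  | succ n ih =>
    obtain ⟨R, hR⟩ := ih
    -- With `u = (1 - z)⁻¹` one has `du/dz = u ^ 2` and `z * u ^ 2 = u ^ 2 - u`.
    refine ⟨R + R.derivative * (Polynomial.X ^ 2 - Polynomial.X), fun z hz => ?_⟩
    have h1 : (1 : ℂ) - z ≠ 0 := sub_ne_zero.2 hz.symm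
    have hev : polylogNeg n =ᶠ[𝓝 z] fun z => z * R.eval (1 - z)⁻¹ := by
      filter_upwards [isOpen_ne.mem_nhds hz] with w hw using hR w hw
    have hi : HasDerivAt (fun z : ℂ => (1 - z)⁻¹) (((1 - z) ^ 2)⁻¹) z := by
      exact (((hasDerivAt_id z).const_sub 1).inv h1).congr_deriv (by simp)
    have hd : HasDerivAt (fun z : ℂ => z * R.eval (1 - z)⁻¹)
        (1 * R.eval (1 - z)⁻¹ + z * (R.derivative.eval (1 - z)⁻¹ * ((1 - z) ^ 2)⁻¹)) z :=
      (hasDerivAt_id z).mul ((R.hasDerivAt _).comp z hi)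
    change z * deriv (polylogNeg n) z = _
    rw [hev.deriv_eq, hd.deriv]
    simp only [Polynomial.eval_add, Polynomial.eval_mul, Polynomial.eval_sub, Polynomial.eval_pow,
      Polynomial.eval_X]
    field_simp
    ring

theorem differentiableAt_polylogNeg (n : ℕ) {z : ℂ} (hz : z ≠ 1) :
    DifferentiableAt ℂ (polylogNeg n) z := by
  obtain ⟨R, hR⟩ := polylogNeg_eq_mul_eval n
  have hev : polylogNeg n =ᶠ[𝓝 z] fun z => z * R.eval (1 - z)⁻¹ := by
    filter_upwards [isOpen_ne.mem_nhds hz] with w hw using hR w hw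
  refine hev.differentiableAt_iff.2 ?_
  have h1 : (1 : ℂ) - z ≠ 0 := sub_ne_zero.2 hz.symm
  have hi : DifferentiableAt ℂ (fun z : ℂ => (1 - z)⁻¹) z := by fun_prop (disch := assumption)
  exact differentiableAt_id.mul (R.differentiableAt.comp z hi)

/-- Away from `z = 1` the variable `(1 - z)⁻¹` stays in a compact ball, where the polynomial is
bounded. The factor `z` pulled out of the polynomial is what later becomes exponential decay. -/
theorem norm_polylogNeg_le (n : ℕ) {c : ℝ} (hc : 0 < c) :
    ∃ C : ℝ, 0 ≤ C ∧ ∀ z : ℂ, c ≤ ‖1 - z‖ → ‖polylogNeg n z‖ ≤ C * ‖z‖ := by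
  obtain ⟨R, hR⟩ := polylogNeg_eq_mul_eval n
  obtain ⟨C, hC⟩ := (isCompact_closedBall (0 : ℂ) c⁻¹).exists_bound_of_continuousOn
    R.continuous.continuousOn
  refine ⟨max C 0, le_max_right _ _, fun z hz => ?_⟩
  have hz1 : z ≠ 1 := by
    rintro rfl
    simp at hz
    linarith
  rw [hR z hz1, norm_mul, mul_comm]
  gcongr
  refine (hC _ ?_).trans (le_max_left _ _)
  rw [mem_closedBall_zero_iff, norm_inv]
  exact inv_anti₀ hc hz

theorem hasDerivAt_polylogNeg_exp (n : ℕ) {w : ℂ} (hw : exp (-w) ≠ 1) :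
    HasDerivAt (fun w => polylogNeg n (exp (-w))) (-polylogNeg (n + 1) (exp (-w))) w := by
  have h1 : HasDerivAt (fun w : ℂ => exp (-w)) (exp (-w) * -1) w := (hasDerivAt_neg w).cexp
  refine ((differentiableAt_polylogNeg n hw).hasDerivAt.comp w h1).congr_deriv ?_
  change _ = -(exp (-w) * deriv (polylogNeg n) (exp (-w)))
  ring

theorem hasDerivAt_add_mul (y β : ℂ) (s : ℝ) : HasDerivAt (fun s : ℝ => y + s * β) β s := by
  simpa using ((ofRealCLM.hasDerivAt (x := s)).mul_const β).const_add y

theorem hasDerivAt_polylogNeg_ray (n : ℕ) {β y : ℂ} {s : ℝ} (h : exp (-(y + s * β)) ≠ 1) :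
    HasDerivAt (fun s : ℝ => polylogNeg n (exp (-(y + s * β))))
      (-(β * polylogNeg (n + 1) (exp (-(y + s * β))))) s := by
  exact ((hasDerivAt_polylogNeg_exp n h).scomp s (hasDerivAt_add_mul y β s)).congr_deriv
    (by rw [smul_eq_mul, mul_neg])

/-! ### The cut plane and decay along rays -/

/-- A point is on a cut exactly when its forward ray in the direction `β` meets `2πiℤ`. -/
theorem mem_cutPlane_iff {β y : ℂ} :
    y ∈ cutPlane β ↔ ∀ s : ℝ, 0 ≤ s → exp (-(y + s * β)) ≠ 1 := by
  constructor
  · intro h s hs he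
    obtain ⟨n, hn⟩ := exp_eq_one_iff.1 he
    refine h (-n) (-s) (by linarith) ?_
    push_cast
    linear_combination -hn
  · intro h n t ht he
    refine h (-t) (by linarith) (exp_eq_one_iff.2 ⟨-n, ?_⟩)
    rw [he]
    push_cast
    ring

theorem add_mul_mem_cutPlane {β y : ℂ} (hy : y ∈ cutPlane β) {t : ℝ} (ht : 0 ≤ t) :
    y + t * β ∈ cutPlane β := by
  rw [mem_cutPlane_iff] at hy ⊢
  intro s hs
  have := hy (t + s) (by linarith)
  rwa [ofReal_add, add_mul, ← add_assoc] at this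

theorem exp_neg_ne_one_of_re_pos {w : ℂ} (hw : 0 < w.re) : exp (-w) ≠ 1 := by
  intro h
  have := congrArg norm h
  rw [norm_exp] at this
  simp at this
  linarith

theorem mem_cutPlane_of_re_pos {β y : ℂ} (hβ : 0 < β.re) (hy : 0 < y.re) : y ∈ cutPlane β := by
  rw [mem_cutPlane_iff]
  intro s hs
  apply exp_neg_ne_one_of_re_pos
  simp
  positivity

theorem half_le_norm_one_sub_exp {w : ℂ} (hw : 1 ≤ w.re) : 1 / 2 ≤ ‖1 - exp (-w)‖ := by
  have h1 : ‖exp (-w)‖ ≤ 1 / 2 := by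
    rw [norm_exp, neg_re, Real.exp_neg, one_div]
    exact inv_anti₀ (by norm_num) (by linarith [Real.add_one_le_exp w.re])
  have h2 := norm_sub_norm_le (1 : ℂ) (exp (-w))
  rw [norm_one] at h2
  linarith

theorem eventually_le_norm_one_sub_exp {β y₀ : ℂ} (hβ : 0 < β.re) (hy : y₀ ∈ cutPlane β) :
    ∃ c : ℝ, 0 < c ∧ ∀ᶠ y in 𝓝 y₀, ∀ s : ℝ, 0 ≤ s → c ≤ ‖1 - exp (-(y + s * β))‖ := by
  rw [mem_cutPlane_iff] at hy
  -- Compactness handles `s ≤ S`. Beyond `S` the real part suffices: the value 2 leaves a margin of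
  -- 1 for moving `y` near `y₀`.
  obtain ⟨S, hS0, hS⟩ : ∃ S : ℝ, 0 ≤ S ∧ 2 ≤ y₀.re + S * β.re := by
    refine ⟨max 0 ((2 - y₀.re) / β.re), le_max_left _ _, ?_⟩
    have := (div_le_iff₀ hβ).1 (le_max_right 0 ((2 - y₀.re) / β.re))
    linarith
  have hcont : Continuous fun p : ℂ × ℝ => ‖1 - exp (-(p.1 + p.2 * β))‖ := by fun_prop
  obtain ⟨m, hm0, hm⟩ : ∃ m : ℝ, 0 < m ∧ ∀ s ∈ Icc 0 S, m ≤ ‖1 - exp (-(y₀ + s * β))‖ := by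
    obtain ⟨s₀, hs₀, hmin⟩ := isCompact_Icc.exists_isMinOn (nonempty_Icc.2 hS0)
      (hcont.comp (Continuous.prodMk_right y₀)).continuousOn
    refine ⟨_, ?_, fun s hs => hmin hs⟩
    exact norm_pos_iff.2 (sub_ne_zero.2 (hy s₀ hs₀.1).symm)
  have h1 : ∀ᶠ y in 𝓝 y₀, ∀ s ∈ Icc 0 S, m / 2 < ‖1 - exp (-(y + s * β))‖ := by
    refine isCompact_Icc.eventually_forall_of_forall_eventually fun s hs => ?_
    exact hcont.continuousAt.eventually (lt_mem_nhds (by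
      change m / 2 < ‖1 - exp (-(y₀ + s * β))‖
      linarith [hm s hs]))
  have h2 : ∀ᶠ y : ℂ in 𝓝 y₀, y₀.re - 1 < y.re :=
    continuous_re.continuousAt.eventually (lt_mem_nhds (by linarith))
  refine ⟨min (m / 2) (1 / 2), by positivity, ?_⟩
  filter_upwards [h1, h2] with y hy1 hy2 s hs
  rcases le_total s S with h | h
  · exact (min_le_left _ _).trans (hy1 s ⟨hs, h⟩).le
  · refine (min_le_right _ _).trans (half_le_norm_one_sub_exp ?_)
    have : S * β.re ≤ s * β.re := by gcongr
    simp
    linarith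

theorem isOpen_cutPlane {β : ℂ} (hβ : 0 < β.re) : IsOpen (cutPlane β) := by
  rw [isOpen_iff_mem_nhds]
  intro y hy
  obtain ⟨c, hc, h⟩ := eventually_le_norm_one_sub_exp hβ hy
  filter_upwards [h] with z hz
  rw [mem_cutPlane_iff]
  intro s hs he
  have := hz s hs
  rw [he, sub_self, norm_zero] at this
  linarith

/-- Locally uniform exponential decay along the rays `y + β ℝ_{≥ 0}`. -/
theorem eventually_norm_polylogNeg_ray_le (n : ℕ) {β y₀ : ℂ} (hβ : 0 < β.re)
    (hy : y₀ ∈ cutPlane β) :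
    ∃ C : ℝ, 0 ≤ C ∧ ∀ᶠ y in 𝓝 y₀, ∀ s : ℝ, 0 ≤ s →
      ‖polylogNeg n (exp (-(y + s * β)))‖ ≤ C * Real.exp (-(β.re * s)) := by
  obtain ⟨c, hc, h⟩ := eventually_le_norm_one_sub_exp hβ hy
  obtain ⟨C, hC, hn⟩ := norm_polylogNeg_le n hc
  have h2 : ∀ᶠ y : ℂ in 𝓝 y₀, y₀.re - 1 < y.re :=
    continuous_re.continuousAt.eventually (lt_mem_nhds (by linarith))
  refine ⟨C * Real.exp (-(y₀.re - 1)), by positivity, ?_⟩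
  filter_upwards [h, h2] with y hy1 hy2 s hs
  refine (hn _ (hy1 s hs)).trans ?_
  rw [mul_assoc, ← Real.exp_add, norm_exp]
  gcongr
  simp
  linarith

theorem integrableOn_pow_mul_exp_neg (k : ℕ) {b : ℝ} (hb : 0 < b) :
    IntegrableOn (fun s : ℝ => s ^ k * Real.exp (-(b * s))) (Ioi 0) := by
  have := integrableOn_rpow_mul_exp_neg_mul_rpow (p := 1) (s := k) (b := b)
    (by linarith [(Nat.cast_nonneg k : (0 : ℝ) ≤ k)]) one_pos hb
  refine this.congr_fun (fun s _ => ?_) measurableSet_Ioi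
  simp

theorem tendsto_pow_mul_exp_neg_mul (k : ℕ) {b : ℝ} (hb : 0 < b) :
    Tendsto (fun s : ℝ => s ^ k * Real.exp (-(b * s))) atTop (𝓝 0) := by
  have h := (Real.tendsto_pow_mul_exp_neg_atTop_nhds_zero k).comp
    (tendsto_id.const_mul_atTop hb)
  have h2 := h.const_mul ((b ^ k)⁻¹)
  rw [mul_zero] at h2
  refine h2.congr fun s => ?_
  simp only [Function.comp, id, mul_pow]
  field_simp

theorem norm_polylogNeg_ray_le (n : ℕ) {β y : ℂ} (hβ : 0 < β.re) (hy : y ∈ cutPlane β) :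
    ∃ C : ℝ, 0 ≤ C ∧ ∀ s : ℝ, 0 ≤ s →
      ‖polylogNeg n (exp (-(y + s * β)))‖ ≤ C * Real.exp (-(β.re * s)) := by
  obtain ⟨C, hC, h⟩ := eventually_norm_polylogNeg_ray_le n hβ hy
  exact ⟨C, hC, h.self_of_nhds⟩

theorem continuousOn_pow_mul_polylogNeg_ray (k n : ℕ) {β y : ℂ} (hy : y ∈ cutPlane β) :
    ContinuousOn (fun s : ℝ => (s : ℂ) ^ k * polylogNeg n (exp (-(y + s * β)))) (Ici 0) := by
  intro s hs
  have h1 := (hasDerivAt_polylogNeg_ray n (mem_cutPlane_iff.1 hy s hs)).continuousAt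
  have h2 : ContinuousAt (fun s : ℝ => (s : ℂ) ^ k) s := by fun_prop
  exact (h2.mul h1).continuousWithinAt

theorem hasDerivAt_integral_pow_mul_polylogNeg_ray (k n : ℕ) {β y : ℂ} (hβ : 0 < β.re)
    (hy : y ∈ cutPlane β) :
    HasDerivAt (fun y => ∫ s in Ioi (0 : ℝ), (s : ℂ) ^ k * polylogNeg n (exp (-(y + s * β))))
      (∫ s in Ioi (0 : ℝ), (s : ℂ) ^ k * -polylogNeg (n + 1) (exp (-(y + s * β)))) y := by
  obtain ⟨C, hC, h⟩ := eventually_norm_polylogNeg_ray_le n hβ hy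
  obtain ⟨C', hC', h'⟩ := eventually_norm_polylogNeg_ray_le (n + 1) hβ hy
  have hopen := (isOpen_cutPlane hβ).mem_nhds hy
  have hmeas : ∀ m : ℕ, ∀ᶠ x in 𝓝 y, AEStronglyMeasurable
      (fun s : ℝ => (s : ℂ) ^ k * polylogNeg m (exp (-(x + s * β)))) (volume.restrict (Ioi 0)) := by
    intro m
    filter_upwards [hopen] with x hx
    exact ((continuousOn_pow_mul_polylogNeg_ray k m hx).mono Ioi_subset_Ici_self).aestronglyMeasurable
      measurableSet_Ioi
  have hb (D : ℝ) : IntegrableOn (fun s : ℝ => D * (s ^ k * Real.exp (-(β.re * s)))) (Ioi 0) :=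
    (integrableOn_pow_mul_exp_neg k hβ).const_mul D
  have hbd : ∀ (m : ℕ) (D : ℝ) (x : ℂ) (s : ℝ), 0 < s →
      ‖polylogNeg m (exp (-(x + s * β)))‖ ≤ D * Real.exp (-(β.re * s)) →
      ‖(s : ℂ) ^ k * polylogNeg m (exp (-(x + s * β)))‖ ≤
        D * (s ^ k * Real.exp (-(β.re * s))) := by
    intro m D x s hs hle
    rw [norm_mul, norm_pow, norm_real, Real.norm_of_nonneg hs.le]
    calc _ ≤ s ^ k * (D * Real.exp (-(β.re * s))) := by gcongr
      _ = _ := by ring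
  have hset := h'.and hopen
  refine (hasDerivAt_integral_of_dominated_loc_of_deriv_le
    (F' := fun y (s : ℝ) => (s : ℂ) ^ k * -polylogNeg (n + 1) (exp (-(y + s * β))))
    hset (hmeas n) ?_ ?_ ?_ (hb C') ?_).2
  · refine (hb C).mono' (hmeas n).self_of_nhds ?_
    filter_upwards [ae_restrict_mem measurableSet_Ioi] with s hs
    exact hbd n C y s hs (h.self_of_nhds s (le_of_lt hs))
  · refine (hmeas (n + 1)).self_of_nhds.neg.congr (Eventually.of_forall fun s => ?_)
    simp
  · filter_upwards [ae_restrict_mem measurableSet_Ioi] with s hs x hx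
    rw [mul_neg, norm_neg]
    exact hbd (n + 1) C' x s hs (hx.1 s (le_of_lt hs))
  · filter_upwards [ae_restrict_mem measurableSet_Ioi] with s hs x hx
    refine HasDerivAt.const_mul _ ?_
    have h1 := hasDerivAt_polylogNeg_exp n (mem_cutPlane_iff.1 hx.2 s (le_of_lt hs))
    simpa using h1.comp_add_const x (s * β)

theorem integrableOn_pow_mul_polylogNeg_ray (k n : ℕ) {β y : ℂ} (hβ : 0 < β.re)
    (hy : y ∈ cutPlane β) :
    IntegrableOn (fun s : ℝ => (s : ℂ) ^ k * polylogNeg n (exp (-(y + s * β)))) (Ioi 0) := by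
  obtain ⟨C, hC, h⟩ := norm_polylogNeg_ray_le n hβ hy
  refine ((integrableOn_pow_mul_exp_neg k hβ).const_mul C).mono'
    (((continuousOn_pow_mul_polylogNeg_ray k n hy).mono
      Ioi_subset_Ici_self).aestronglyMeasurable measurableSet_Ioi) ?_
  filter_upwards [ae_restrict_mem measurableSet_Ioi] with s hs
  have hs' : 0 < s := hs
  rw [norm_mul, norm_pow, norm_real, Real.norm_of_nonneg hs'.le]
  calc _ ≤ s ^ k * (C * Real.exp (-(β.re * s))) := by
        gcongr
        exact h s hs'.le
    _ = _ := by ring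

theorem tendsto_pow_mul_polylogNeg_ray (k n : ℕ) {β y : ℂ} (hβ : 0 < β.re)
    (hy : y ∈ cutPlane β) :
    Tendsto (fun s : ℝ => (s : ℂ) ^ k * polylogNeg n (exp (-(y + s * β)))) atTop (𝓝 0) := by
  obtain ⟨C, hC, h⟩ := norm_polylogNeg_ray_le n hβ hy
  have h0 := (tendsto_pow_mul_exp_neg_mul k hβ).const_mul C
  rw [mul_zero] at h0
  refine squeeze_zero_norm' ?_ h0
  filter_upwards [eventually_ge_atTop 0] with s hs
  rw [norm_mul, norm_pow, norm_real, Real.norm_of_nonneg hs]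
  calc _ ≤ s ^ k * (C * Real.exp (-(β.re * s))) := by
        gcongr
        exact h s hs
    _ = _ := by ring

/-! ### The ray integrals as branches of the logarithm and the dilogarithm -/

theorem logOneSubExp_eq (β y : ℂ) : logOneSubExp β y =
    -β * ∫ s in Ioi (0 : ℝ), (s : ℂ) ^ 0 * polylogNeg 0 (exp (-(y + s * β))) := by
  simp only [pow_zero, one_mul]
  rw [logOneSubExp, neg_mul, integral_const_mul]

theorem dilogExp_eq (β y : ℂ) : dilogExp β y =
    β ^ 2 * ∫ s in Ioi (0 : ℝ), (s : ℂ) ^ 1 * polylogNeg 0 (exp (-(y + s * β))) := by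
  simp only [pow_one]
  rw [dilogExp, ← integral_const_mul]
  simp only [mul_assoc]

/-- Differentiation in `y`, multiplied by `β`, is differentiation in `s`. The differentiated
integrand is therefore a total derivative, and only the endpoint `s = 0` contributes. -/
theorem hasDerivAt_logOneSubExp {β y : ℂ} (hβ : 0 < β.re) (hy : y ∈ cutPlane β) :
    HasDerivAt (logOneSubExp β) (polylogNeg 0 (exp (-y))) y := by
  have h := (hasDerivAt_integral_pow_mul_polylogNeg_ray 0 0 hβ hy).const_mul (-β)
  rw [show logOneSubExp β = _ from funext (logOneSubExp_eq β)]
  refine h.congr_deriv ?_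
  have h2 := integral_Ioi_of_hasDerivAt_of_tendsto'
    (fun s hs => hasDerivAt_polylogNeg_ray 0 (mem_cutPlane_iff.1 hy s hs))
    (by simpa [IntegrableOn] using
      ((integrableOn_pow_mul_polylogNeg_ray 0 1 hβ hy).const_mul β).neg)
    (by simpa using tendsto_pow_mul_polylogNeg_ray 0 0 hβ hy)
  rw [← integral_const_mul]
  simp only [pow_zero, one_mul, neg_mul_neg, zero_add]
  simp only [ofReal_zero, zero_mul, add_zero, zero_sub, zero_add] at h2
  rw [integral_neg] at h2
  exact neg_injective h2

theorem hasDerivAt_dilogExp {β y : ℂ} (hβ : 0 < β.re) (hy : y ∈ cutPlane β) :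
    HasDerivAt (dilogExp β) (logOneSubExp β y) y := by
  have h := (hasDerivAt_integral_pow_mul_polylogNeg_ray 1 0 hβ hy).const_mul (β ^ 2)
  rw [show dilogExp β = _ from funext (dilogExp_eq β)]
  refine h.congr_deriv ?_
  have i0 := integrableOn_pow_mul_polylogNeg_ray 0 0 hβ hy
  have i1 := integrableOn_pow_mul_polylogNeg_ray 1 1 hβ hy
  simp only [pow_zero, one_mul, pow_one] at i0 i1
  have i2 : IntegrableOn (fun s : ℝ => β * (s * polylogNeg 1 (exp (-(y + s * β))))) (Ioi 0) :=
    i1.const_mul β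
  -- Integration by parts against the weight `s`; both boundary terms vanish.
  have h2 := integral_Ioi_of_hasDerivAt_of_tendsto' (a := 0) (m := 0)
    (f := fun s : ℝ => (s : ℂ) * polylogNeg 0 (exp (-(y + s * β))))
    (f' := fun s : ℝ => polylogNeg 0 (exp (-(y + s * β))) -
      β * (s * polylogNeg 1 (exp (-(y + s * β)))))
    (fun s hs => by
      have := ((ofRealCLM.hasDerivAt (x := s))).mul
        (hasDerivAt_polylogNeg_ray 0 (mem_cutPlane_iff.1 hy s hs))
      refine this.congr_deriv ?_
      simp
      ring)
    (i0.sub i2)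
    (by simpa using tendsto_pow_mul_polylogNeg_ray 1 0 hβ hy)
  rw [integral_sub i0 i2, integral_const_mul] at h2
  rw [logOneSubExp_eq]
  simp only [pow_zero, one_mul, pow_one, mul_neg, zero_add]
  rw [integral_neg]
  simp only [ofReal_zero, zero_mul, sub_zero] at h2
  linear_combination β * h2

theorem polylogNeg_ray_shift (n : ℕ) (β y : ℂ) (t s : ℝ) :
    polylogNeg n (exp (-(y + t * β + s * β))) = polylogNeg n (exp (-(y + (t + s : ℝ) * β))) := by
  congr 3
  push_cast
  ring

/-- The ray from `y + tβ` is a tail of the ray from `y`, so the pointwise decay bound splits off the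
factor in `t`. This gives both the limits at infinity and the summability over `y + kβ`. -/
theorem norm_integral_ray_shift_le (k : ℕ) {β y : ℂ} (hβ : 0 < β.re) (hy : y ∈ cutPlane β) :
    ∃ C : ℝ, 0 ≤ C ∧ ∀ᶠ y in 𝓝 y, ∀ t : ℝ, 0 ≤ t →
      ‖∫ s in Ioi (0 : ℝ), (s : ℂ) ^ k * polylogNeg 0 (exp (-(y + t * β + s * β)))‖ ≤
        C * Real.exp (-(β.re * t)) := by
  obtain ⟨C, hC, h⟩ := eventually_norm_polylogNeg_ray_le 0 hβ hy
  refine ⟨C * ∫ s in Ioi (0 : ℝ), s ^ k * Real.exp (-(β.re * s)), ?_, ?_⟩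
  · refine mul_nonneg hC (setIntegral_nonneg measurableSet_Ioi fun s hs => ?_)
    have hs' : 0 < s := hs
    positivity
  filter_upwards [h] with y h t ht
  rw [mul_right_comm, ← integral_const_mul]
  refine norm_integral_le_of_norm_le ((integrableOn_pow_mul_exp_neg k hβ).const_mul _) ?_
  filter_upwards [ae_restrict_mem measurableSet_Ioi] with s hs
  have hs' : 0 < s := hs
  rw [norm_mul, norm_pow, norm_real, Real.norm_of_nonneg hs'.le, polylogNeg_ray_shift]
  calc _ ≤ s ^ k * (C * Real.exp (-(β.re * (t + s)))) := by
        gcongr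
        exact h (t + s) (by positivity)
    _ = _ := by
      rw [mul_add, neg_add, Real.exp_add]
      ring

theorem tendsto_logOneSubExp_ray {β y : ℂ} (hβ : 0 < β.re) (hy : y ∈ cutPlane β) :
    Tendsto (fun t : ℝ => logOneSubExp β (y + t * β)) atTop (𝓝 0) := by
  obtain ⟨C, hC, h⟩ := norm_integral_ray_shift_le 0 hβ hy
  have h0 := (tendsto_pow_mul_exp_neg_mul 0 hβ).const_mul (‖β‖ * C)
  rw [mul_zero] at h0
  refine squeeze_zero_norm' ?_ h0
  filter_upwards [eventually_ge_atTop 0] with t ht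
  rw [logOneSubExp_eq, norm_mul, norm_neg, pow_zero, one_mul, mul_assoc]
  gcongr
  exact h.self_of_nhds t ht

theorem tendsto_dilogExp_ray {β y : ℂ} (hβ : 0 < β.re) (hy : y ∈ cutPlane β) :
    Tendsto (fun t : ℝ => dilogExp β (y + t * β)) atTop (𝓝 0) := by
  obtain ⟨C, hC, h⟩ := norm_integral_ray_shift_le 1 hβ hy
  have h0 := (tendsto_pow_mul_exp_neg_mul 0 hβ).const_mul (‖β ^ 2‖ * C)
  rw [mul_zero] at h0
  refine squeeze_zero_norm' ?_ h0
  filter_upwards [eventually_ge_atTop 0] with t ht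
  rw [dilogExp_eq, norm_mul, pow_zero, one_mul, mul_assoc]
  gcongr
  exact h.self_of_nhds t ht

theorem eventually_norm_logOneSubExp_ray_le {β y : ℂ} (hβ : 0 < β.re) (hy : y ∈ cutPlane β) :
    ∃ C : ℝ, 0 ≤ C ∧ ∀ᶠ y in 𝓝 y, ∀ k : ℕ,
      ‖logOneSubExp β (y + k * β)‖ ≤ C * Real.exp (-β.re) ^ k := by
  obtain ⟨C, hC, h⟩ := norm_integral_ray_shift_le 0 hβ hy
  refine ⟨‖β‖ * C, by positivity, ?_⟩
  filter_upwards [h] with y h k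
  rw [logOneSubExp_eq, norm_mul, norm_neg, mul_assoc, ← Real.exp_nat_mul]
  gcongr
  have := h k k.cast_nonneg
  rw [ofReal_natCast] at this
  refine this.trans_eq ?_
  congr 2
  ring

theorem summable_exp_neg_pow {b : ℝ} (hb : 0 < b) : Summable fun k : ℕ => Real.exp (-b) ^ k :=
  summable_geometric_of_lt_one (Real.exp_nonneg _) (by simpa using hb)

theorem summable_logOneSubExp {β y : ℂ} (hβ : 0 < β.re) (hy : y ∈ cutPlane β) :
    Summable fun k : ℕ => logOneSubExp β (y + k * β) := by
  obtain ⟨C, hC, h⟩ := eventually_norm_logOneSubExp_ray_le hβ hy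
  exact Summable.of_norm_bounded ((summable_exp_neg_pow hβ).mul_left C) h.self_of_nhds

theorem tendsto_exp_neg_ray {β : ℂ} (y : ℂ) (hβ : 0 < β.re) :
    Tendsto (fun s : ℝ => exp (-(y + s * β))) atTop (𝓝 0) := by
  rw [tendsto_zero_iff_norm_tendsto_zero]
  have h : Tendsto (fun s : ℝ => y.re + s * β.re) atTop atTop :=
    tendsto_atTop_add_const_left _ _ (tendsto_id.atTop_mul_const hβ)
  refine (Real.tendsto_exp_neg_atTop_nhds_zero.comp h).congr fun s => ?_
  simp [norm_exp]

theorem exp_logOneSubExp {β y : ℂ} (hβ : 0 < β.re) (hy : y ∈ cutPlane β) :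
    exp (logOneSubExp β y) = 1 - exp (-y) := by
  -- The quotient of the two sides is constant along the ray and tends to 1 at infinity.
  set g : ℝ → ℂ := fun s => exp (-logOneSubExp β (y + s * β)) * (1 - exp (-(y + s * β))) with hg
  have hd : ∀ s ∈ Ici (0 : ℝ), HasDerivAt g 0 s := by
    intro s hs
    have hray := hasDerivAt_add_mul y β s
    have h1 := (hasDerivAt_logOneSubExp hβ (add_mul_mem_cutPlane hy hs)).scomp s hray
    have h2 := hray.neg.cexp.const_sub 1
    have hne : 1 - exp (-(y + s * β)) ≠ 0 := sub_ne_zero.2 (mem_cutPlane_iff.1 hy s hs).symm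
    refine (h1.neg.cexp.mul h2).congr_deriv ?_
    simp only [polylogNeg, smul_eq_mul, Pi.neg_apply, Function.comp]
    field_simp
    ring
  have hlim : Tendsto g atTop (𝓝 1) := by
    have h1 := (tendsto_logOneSubExp_ray hβ hy).neg.cexp
    simpa [hg] using h1.mul ((tendsto_exp_neg_ray y hβ).const_sub 1)
  have hconst := integral_Ioi_of_hasDerivAt_of_tendsto' (f' := fun _ => (0 : ℂ)) hd (by simp) hlim
  simp only [integral_zero, hg, ofReal_zero, zero_mul, add_zero] at hconst
  rw [exp_neg] at hconst
  have hne := exp_ne_zero (logOneSubExp β y)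
  field_simp at hconst
  linear_combination -hconst

/-- On the ray `1 - e^{-w}` stays in the right half-plane, so the principal logarithm is an
antiderivative of the integrand, and it vanishes at infinity. -/
theorem logOneSubExp_of_re_pos {β y : ℂ} (hβ : 0 < β.re) (hy : 0 < y.re) :
    logOneSubExp β y = log (1 - exp (-y)) := by
  have hslit : ∀ w : ℂ, 0 < w.re → 1 - exp (-w) ∈ slitPlane := by
    intro w hw
    refine mem_slitPlane_iff.2 (Or.inl ?_)
    have h1 := re_le_norm (exp (-w))
    have h2 : ‖exp (-w)‖ < 1 := by
      rw [norm_exp]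
      simpa using hw
    simp only [sub_re, one_re]
    linarith
  have hre : ∀ s : ℝ, 0 ≤ s → 0 < (y + s * β).re := by
    intro s hs
    simp
    positivity
  have hmem := mem_cutPlane_of_re_pos hβ hy
  have hlim : Tendsto (fun s : ℝ => log (1 - exp (-(y + s * β)))) atTop (𝓝 0) := by
    have h1 : Tendsto (fun s : ℝ => 1 - exp (-(y + s * β))) atTop (𝓝 1) := by
      simpa using (tendsto_exp_neg_ray y hβ).const_sub 1
    simpa using h1.clog one_mem_slitPlane
  have h2 := integral_Ioi_of_hasDerivAt_of_tendsto' (a := 0)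
    (f' := fun s : ℝ => β * polylogNeg 0 (exp (-(y + s * β))))
    (fun s hs => by
      have hray := hasDerivAt_add_mul y β s
      refine ((hray.neg.cexp.const_sub 1).clog_real (hslit _ (hre s hs))).congr_deriv ?_
      simp only [polylogNeg, Pi.neg_apply]
      ring)
    (by simpa [IntegrableOn] using (integrableOn_pow_mul_polylogNeg_ray 0 0 hβ hmem).const_mul β)
    hlim
  rw [logOneSubExp, h2]
  simp

theorem isLogOneSubExpBranch_logOneSubExp {β : ℂ} (hβ : 0 < β.re) :
    IsLogOneSubExpBranch β (logOneSubExp β) where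
  analytic := DifferentiableOn.analyticOnNhd
    (fun _ hy => (hasDerivAt_logOneSubExp hβ hy).differentiableAt.differentiableWithinAt)
    (isOpen_cutPlane hβ)
  exp_eq _ hy := exp_logOneSubExp hβ hy
  real y hy := by
    rw [logOneSubExp_of_re_pos hβ (by simpa using hy), log_im, arg_eq_zero_iff.2 ?_]
    rw [← ofReal_neg, ← ofReal_exp, ← ofReal_one, ← ofReal_sub, ofReal_re, ofReal_im]
    exact ⟨by simpa using hy.le, rfl⟩

theorem integral_mul_exp_neg_mul {a : ℂ} (ha : 0 < a.re) :
    ∫ s in Ioi (0 : ℝ), (s : ℂ) * exp (-(a * s)) = (a ^ 2)⁻¹ := by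
  have hne : a ≠ 0 := fun h => by simp [h] at ha
  have hnorm : ∀ (k : ℕ) (s : ℝ), 0 ≤ s →
      ‖(s : ℂ) ^ k * exp (-(a * s))‖ = s ^ k * Real.exp (-(a.re * s)) := by
    intro k s hs
    rw [norm_mul, norm_pow, norm_real, Real.norm_of_nonneg hs, norm_exp]
    simp
  have htend : ∀ k : ℕ, Tendsto (fun s : ℝ => (s : ℂ) ^ k * exp (-(a * s))) atTop (𝓝 0) := by
    intro k
    rw [tendsto_zero_iff_norm_tendsto_zero]
    refine (tendsto_pow_mul_exp_neg_mul k ha).congr' ?_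
    filter_upwards [eventually_ge_atTop 0] with s hs using (hnorm k s hs).symm
  have hint : IntegrableOn (fun s : ℝ => (s : ℂ) * exp (-(a * s))) (Ioi 0) := by
    refine (integrableOn_pow_mul_exp_neg 1 ha).mono' ?_ ?_
    · exact (by fun_prop : Continuous fun s : ℝ => (s : ℂ) * exp (-(a * s))).aestronglyMeasurable
    · filter_upwards [ae_restrict_mem measurableSet_Ioi] with s hs
      have := hnorm 1 s (le_of_lt hs)
      rw [pow_one] at this
      exact this.le
  have h := integral_Ioi_of_hasDerivAt_of_tendsto' (a := 0) (m := 0)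
    (f := fun s : ℝ => -(a⁻¹ * ((s : ℂ) ^ 1 * exp (-(a * s))) +
      (a ^ 2)⁻¹ * ((s : ℂ) ^ 0 * exp (-(a * s)))))
    (f' := fun s : ℝ => (s : ℂ) * exp (-(a * s)))
    (fun s _ => by
      have h1 : HasDerivAt (fun s : ℝ => (s : ℂ)) 1 s := ofRealCLM.hasDerivAt (x := s)
      have h2 := (h1.const_mul a).neg.cexp
      simp only [pow_one, pow_zero, one_mul]
      refine ((((h1.mul h2).const_mul a⁻¹).add (h2.const_mul (a ^ 2)⁻¹)).neg).congr_deriv ?_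
      simp only [Pi.neg_apply]
      field_simp
      ring)
    hint
    (by simpa using ((((htend 1).const_mul a⁻¹).add ((htend 0).const_mul (a ^ 2)⁻¹)).neg))
  rw [h]
  simp

/-- The geometric series of the integrand is integrated termwise; each term is a Gamma integral with
value `1 / ((n + 1) β) ^ 2`, up to its constant factor. -/
theorem hasSum_dilogExp {β y : ℂ} (hβ : 0 < β.re) (hy : 0 < y.re) :
    HasSum (fun n : ℕ => exp (-y) ^ (n + 1) / ((n : ℂ) + 1) ^ 2) (dilogExp β y) := by
  have hβ0 : β ≠ 0 := fun h => by simp [h] at hβ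
  set F : ℕ → ℝ → ℂ := fun n s => (β ^ 2 * s) * exp (-(y + s * β)) ^ (n + 1) with hF
  have hlt : ∀ s : ℝ, 0 ≤ s → ‖exp (-(y + s * β))‖ < 1 := by
    intro s hs
    rw [norm_exp, Real.exp_lt_one_iff]
    have : 0 ≤ s * β.re := by positivity
    simp
    linarith
  have hexp : ∀ (n : ℕ) (s : ℝ), F n s =
      (β ^ 2 * exp (-y) ^ (n + 1)) * (s * exp (-((n + 1) * β * s))) := by
    intro n s
    have : exp (-(y + s * β)) ^ (n + 1) = exp (-y) ^ (n + 1) * exp (-((n + 1) * β * s)) := by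
      rw [← exp_nat_mul, ← exp_nat_mul, ← exp_add]
      congr 1
      push_cast
      ring
    simp only [hF, this]
    ring
  have hnorm : ∀ (n : ℕ) (s : ℝ), 0 < s →
      ‖F n s‖ ≤ ‖β‖ ^ 2 * Real.exp (-y.re) ^ (n + 1) * (s ^ 1 * Real.exp (-(β.re * s))) := by
    intro n s hs
    rw [hexp, norm_mul, norm_mul, norm_mul, norm_pow, norm_pow, norm_exp, norm_exp, norm_real,
      Real.norm_of_nonneg hs.le, pow_one]
    have : 0 ≤ (n : ℝ) * (β.re * s) := by positivity
    gcongr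
    · simp
    · simp
      linarith
  have hdom := fun n : ℕ => (integrableOn_pow_mul_exp_neg 1 hβ).const_mul
    (‖β‖ ^ 2 * Real.exp (-y.re) ^ (n + 1))
  have hmeas : ∀ n, AEStronglyMeasurable (F n) (volume.restrict (Ioi 0)) := fun n =>
    (by fun_prop : Continuous (F n)).aestronglyMeasurable
  have hint : ∀ n, Integrable (F n) (volume.restrict (Ioi 0)) := fun n => by
    refine (hdom n).mono' (hmeas n) ?_
    filter_upwards [ae_restrict_mem measurableSet_Ioi] with s hs using hnorm n s hs
  have hsum : Summable fun n => ∫ s in Ioi (0 : ℝ), ‖F n s‖ := by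
    refine Summable.of_nonneg_of_le (fun n => integral_nonneg fun s => norm_nonneg _)
      (fun n => setIntegral_mono_on (hint n).norm (hdom n) measurableSet_Ioi (hnorm n)) ?_
    simp only [integral_const_mul]
    exact (((summable_nat_add_iff 1).2 (summable_exp_neg_pow hy)).mul_left _).mul_right _
  have key := hasSum_integral_of_summable_integral_norm hint hsum
  have hL : ∫ s in Ioi (0 : ℝ), ∑' n, F n s = dilogExp β y := by
    rw [dilogExp]
    refine setIntegral_congr_fun measurableSet_Ioi fun s hs => ?_
    have h1 := hlt s (le_of_lt hs)
    simp only [hF, pow_succ, polylogNeg]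
    rw [tsum_mul_left, tsum_mul_right, tsum_geometric_of_norm_lt_one h1]
    ring
  rw [hL] at key
  refine HasSum.congr_fun key fun n => ?_
  have ha : 0 < (((n : ℂ) + 1) * β).re := by
    have : ((n : ℂ) + 1) * β = ((n + 1 : ℝ) : ℂ) * β := by push_cast; rfl
    rw [this, re_ofReal_mul]
    positivity
  have hn : (n : ℂ) + 1 ≠ 0 := n.cast_add_one_ne_zero
  simp only [hexp]
  rw [integral_const_mul, integral_mul_exp_neg_mul ha]
  field_simp

theorem isDilogExpBranch_dilogExp {β : ℂ} (hβ : 0 < β.re) :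
    IsDilogExpBranch β (dilogExp β) where
  analytic := DifferentiableOn.analyticOnNhd
    (fun _ hy => (hasDerivAt_dilogExp hβ hy).differentiableAt.differentiableWithinAt)
    (isOpen_cutPlane hβ)
  hasSum _ hy := hasSum_dilogExp hβ hy
  real y hy := by
    have h := imCLM.hasSum (hasSum_dilogExp (y := y) hβ (by simpa using hy))
    refine h.unique ?_
    convert hasSum_zero with n
    rw [imCLM_apply, ← ofReal_neg, ← ofReal_exp, ← ofReal_natCast, ← ofReal_one, ← ofReal_add,
      ← ofReal_pow, ← ofReal_pow, ← ofReal_div, ofReal_im]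

/-! ### The logarithm of the `q`-Pochhammer symbol -/

theorem isLogQPochBranch_logQPoch {β : ℂ} (hβ : 0 < β.re) :
    IsLogQPochBranch β (logQPoch β) where
  analytic := by
    refine DifferentiableOn.analyticOnNhd (fun y hy => ?_) (isOpen_cutPlane hβ)
    obtain ⟨C, hC, h⟩ := eventually_norm_logOneSubExp_ray_le hβ hy
    obtain ⟨U, hU, hUo, hyU⟩ := eventually_nhds_iff.1
      (h.and ((isOpen_cutPlane hβ).mem_nhds hy))
    refine ((differentiableOn_tsum_of_summable_norm ((summable_exp_neg_pow hβ).mul_left C)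
      (fun k z hz => ?_) hUo fun k z hz => (hU z hz).1 k).differentiableAt
        (hUo.mem_nhds hyU)).differentiableWithinAt
    have hz' := add_mul_mem_cutPlane (hU z hz).2 k.cast_nonneg
    rw [ofReal_natCast] at hz'
    exact ((hasDerivAt_logOneSubExp hβ hz').comp_add_const z _).differentiableAt.differentiableWithinAt
  exp_eq y hy := by
    have h := (summable_logOneSubExp hβ hy).hasSum.cexp.tprod_eq
    rw [logQPoch, ← h, qPoch]
    congr 1
    funext k
    have hz' := add_mul_mem_cutPlane hy k.cast_nonneg
    rw [ofReal_natCast] at hz'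
    rw [Function.comp, exp_logOneSubExp hβ hz', ← exp_nat_mul, ← exp_add]
    congr 2
    ring
  hasSum y hy := by
    refine HasSum.congr_fun (summable_logOneSubExp hβ (mem_cutPlane_of_re_pos hβ hy)).hasSum
      fun k => ?_
    rw [logOneSubExp_of_re_pos hβ]
    · congr 3
      ring
    · rw [← ofReal_natCast, add_re, re_ofReal_mul]
      positivity

theorem tendsto_logQPoch_ray (β y : ℂ) :
    Tendsto (fun n : ℕ => logQPoch β (y + n * β)) atTop (𝓝 0) := by
  refine (tendsto_sum_nat_add fun k : ℕ => logOneSubExp β (y + k * β)).congr fun n => ?_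
  refine tsum_congr fun k => ?_
  congr 1
  push_cast
  ring

theorem logQPoch_eq_add {β y : ℂ} (hβ : 0 < β.re) (hy : y ∈ cutPlane β) :
    logQPoch β y = logOneSubExp β y + logQPoch β (y + β) := by
  rw [logQPoch, (summable_logOneSubExp hβ hy).tsum_eq_zero_add]
  simp only [Nat.cast_zero, zero_mul, add_zero, logQPoch]
  congr 1
  refine tsum_congr fun k => ?_
  congr 1
  push_cast
  ring

/-! ### The logarithm of the Gamma function and Stirling's formula -/

theorem one_add_mul_mem_slitPlane {x : ℂ} (hx : x ∈ slitPlane) {t : ℝ} (ht : 0 ≤ t) :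
    1 + x * t ∈ slitPlane := by
  rcases ht.eq_or_lt with rfl | ht
  · simp
  rw [mem_slitPlane_iff] at hx ⊢
  rcases hx with h | h
  · left
    simp
    positivity
  · right
    simpa using ⟨h, ht.ne'⟩

theorem one_add_div_mem_slitPlane {x : ℂ} (hx : x ∈ slitPlane) (n : ℕ) :
    1 + x / ((n : ℂ) + 1) ∈ slitPlane := by
  have := one_add_mul_mem_slitPlane hx (t := ((n : ℝ) + 1)⁻¹) (by positivity)
  simpa [div_eq_mul_inv] using this

/-- Replacing `1/(n + 1)` by a parameter in the compact interval `[0, 1]` makes the bound uniform in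
`n`. -/
theorem eventually_le_norm_one_add_div {x₀ : ℂ} (hx : x₀ ∈ slitPlane) :
    ∃ c : ℝ, 0 < c ∧ ∀ᶠ x in 𝓝 x₀, ∀ n : ℕ, c ≤ ‖1 + x / ((n : ℂ) + 1)‖ := by
  have hcont : Continuous fun p : ℂ × ℝ => ‖1 + p.1 * p.2‖ := by fun_prop
  obtain ⟨t₀, ht₀, hmin⟩ := isCompact_Icc.exists_isMinOn (nonempty_Icc.2 (zero_le_one' ℝ))
    (hcont.comp (Continuous.prodMk_right x₀)).continuousOn
  have hpos : 0 < ‖1 + x₀ * t₀‖ :=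
    norm_pos_iff.2 (slitPlane_ne_zero (one_add_mul_mem_slitPlane hx ht₀.1))
  refine ⟨‖1 + x₀ * t₀‖ / 2, half_pos hpos, ?_⟩
  have h1 : ∀ᶠ x : ℂ in 𝓝 x₀, ∀ t ∈ Icc (0 : ℝ) 1, ‖1 + x₀ * t₀‖ / 2 < ‖1 + x * t‖ := by
    refine isCompact_Icc.eventually_forall_of_forall_eventually fun t ht => ?_
    exact hcont.continuousAt.eventually (lt_mem_nhds ((half_lt_self hpos).trans_le (hmin ht)))
  filter_upwards [h1] with x h n
  have := h ((n : ℝ) + 1)⁻¹ ⟨by positivity, inv_le_one_of_one_le₀ (by simp)⟩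
  simpa [div_eq_mul_inv] using this.le

theorem summable_one_div_succ_sq : Summable fun n : ℕ => 1 / ((n : ℝ) + 1) ^ 2 := by
  have := (summable_nat_add_iff 1).2 (Real.summable_one_div_nat_pow.2 one_lt_two)
  simpa using this

theorem summable_logGamma_terms (x : ℂ) :
    Summable fun n : ℕ => x / ((n : ℂ) + 1) - log (1 + x / ((n : ℂ) + 1)) := by
  refine Summable.of_norm_bounded_eventually_nat (summable_one_div_succ_sq.mul_left (‖x‖ ^ 2)) ?_
  obtain ⟨m, hm⟩ := exists_nat_ge (2 * ‖x‖)
  filter_upwards [eventually_ge_atTop m] with n hn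
  have hn' : (m : ℝ) ≤ n := by exact_mod_cast hn
  have hz : ‖x / ((n : ℂ) + 1)‖ = ‖x‖ / ((n : ℝ) + 1) := by
    rw [norm_div]
    congr 1
    exact_mod_cast Complex.norm_natCast (n + 1)
  have hz2 : ‖x / ((n : ℂ) + 1)‖ ≤ 1 / 2 := by
    rw [hz, div_le_div_iff₀ (by positivity) (by positivity)]
    linarith
  rw [norm_sub_rev]
  refine (norm_log_one_add_sub_self_le (by linarith)).trans ?_
  have h2 : (1 - ‖x / ((n : ℂ) + 1)‖)⁻¹ ≤ 2 := by
    rw [inv_le_comm₀ (by linarith) (by norm_num)]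
    linarith
  calc _ ≤ ‖x / ((n : ℂ) + 1)‖ ^ 2 * 2 / 2 := by gcongr
    _ = _ := by
      rw [hz]
      field_simp

theorem differentiableAt_logGamma {x : ℂ} (hx : x ∈ slitPlane) :
    DifferentiableAt ℂ logGamma x := by
  obtain ⟨c, hc, h⟩ := eventually_le_norm_one_add_div hx
  obtain ⟨ε, hε, hball⟩ := Metric.eventually_nhds_iff_ball.1
    (h.and (isOpen_slitPlane.mem_nhds hx))
  have hder := hasDerivAt_tsum_of_isPreconnected
    (g := fun (n : ℕ) (x : ℂ) => x / ((n : ℂ) + 1) - log (1 + x / ((n : ℂ) + 1)))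
    (g' := fun (n : ℕ) (x : ℂ) => 1 / ((n : ℂ) + 1) -
      1 / ((n : ℂ) + 1) / (1 + x / ((n : ℂ) + 1)))
    (summable_one_div_succ_sq.mul_left ((‖x‖ + ε) / c)) (Metric.isOpen_ball (x := x) (ε := ε))
    (convex_ball x ε).isPreconnected
    (fun n z hz => by
      have h1 : HasDerivAt (fun z : ℂ => z / ((n : ℂ) + 1)) (1 / ((n : ℂ) + 1)) z :=
        (hasDerivAt_id z).div_const _
      exact h1.sub ((h1.const_add 1).clog (one_add_div_mem_slitPlane (hball z hz).2 n)))
    (fun n z hz => by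
      have hcz := (hball z hz).1 n
      have hne : 1 + z / ((n : ℂ) + 1) ≠ 0 := norm_pos_iff.1 (hc.trans_le hcz)
      have hn : (n : ℂ) + 1 ≠ 0 := n.cast_add_one_ne_zero
      have hnn : ‖(n : ℂ) + 1‖ = (n : ℝ) + 1 := by exact_mod_cast Complex.norm_natCast (n + 1)
      have heq : 1 / ((n : ℂ) + 1) - 1 / ((n : ℂ) + 1) / (1 + z / ((n : ℂ) + 1)) =
          z / (1 + z / ((n : ℂ) + 1)) * (1 / ((n : ℂ) + 1) ^ 2) := by
        obtain ⟨w, hw⟩ : ∃ w, w = 1 + z / ((n : ℂ) + 1) := ⟨_, rfl⟩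
        have hz0 : z = (w - 1) * ((n : ℂ) + 1) := by
          rw [hw]
          field_simp
          ring
        rw [← hw] at hne ⊢
        rw [hz0]
        field_simp
      have hz' : ‖z‖ ≤ ‖x‖ + ε := by
        have := norm_le_norm_add_norm_sub' z x
        rw [Metric.mem_ball, dist_eq] at hz
        linarith
      rw [heq, norm_mul, norm_div, norm_div, norm_pow, hnn, norm_one]
      gcongr)
    (Metric.mem_ball_self hε) (summable_logGamma_terms x) (Metric.mem_ball_self hε)
  have hlog : DifferentiableAt ℂ log x := differentiableAt_log hx
  exact ((differentiableAt_id.const_mul _).sub hlog).add hder.differentiableAt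

/-- The logarithm of Gauss's product for `Γ`. -/
def logGammaSeq (x : ℂ) (n : ℕ) : ℂ :=
  x * (Real.log n : ℂ) + (Real.log n.factorial : ℂ) - ∑ k ∈ Finset.range (n + 1), log (x + k)

/-- A positive real factor does not change the argument, so no multiple of `2πi` appears. -/
theorem log_one_add_div {x : ℂ} {r : ℝ} (hr : 0 < r) (h : x + r ≠ 0) :
    log (x + r) = Real.log r + log (1 + x / r) := by
  have hr' : (r : ℂ) ≠ 0 := ofReal_ne_zero.2 hr.ne'
  have h1 : x + r = (1 + x / r) * r := by field_simp; ring
  rw [h1, log_mul_ofReal _ hr _ (fun h0 => h (by rw [h1, h0, zero_mul]))]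

theorem add_natCast_mem_slitPlane {x : ℂ} (hx : x ∈ slitPlane) (n : ℕ) : x + n ∈ slitPlane := by
  rw [mem_slitPlane_iff] at hx ⊢
  rcases hx with h | h
  · left
    simp
    positivity
  · right
    simpa using h

/-- Gauss's product and the partial Weierstrass product differ only in `harmonic n - log n` against
Euler's constant. The Gauss form makes the functional equation and Stirling's formula accessible. -/
theorem logGammaSeq_eq {x : ℂ} (hx : x ∈ slitPlane) (n : ℕ) :
    logGammaSeq x n = -x * (harmonic n - Real.log n : ℝ) - log x +
      ∑ k ∈ Finset.range n, (x / ((k : ℂ) + 1) - log (1 + x / ((k : ℂ) + 1))) := by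
  have h1 : ∀ k : ℕ, log (x + (k + 1 : ℕ)) = Real.log (k + 1 : ℕ) + log (1 + x / ((k : ℂ) + 1)) := by
    intro k
    have := log_one_add_div (x := x) (r := (k + 1 : ℕ)) (by positivity)
      (by simpa using slitPlane_ne_zero (add_natCast_mem_slitPlane hx (k + 1)))
    simpa using this
  have h2 : (Real.log n.factorial : ℂ) = ∑ k ∈ Finset.range n, (Real.log (k + 1 : ℕ) : ℂ) := by
    induction n with
    | zero => simp
    | succ n ih =>
      rw [Finset.sum_range_succ, ← ih, Nat.factorial_succ, Nat.cast_mul, Real.log_mul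
        (by positivity) (by positivity)]
      push_cast
      ring
  have h3 : ((harmonic n : ℝ) : ℂ) = ∑ k ∈ Finset.range n, 1 / ((k : ℂ) + 1) := by
    simp [harmonic]
  rw [logGammaSeq, Finset.sum_range_succ', h2, Finset.sum_sub_distrib]
  simp only [h1, Finset.sum_add_distrib, Nat.cast_zero, add_zero]
  rw [ofReal_sub, h3, mul_sub, Finset.mul_sum]
  simp only [div_eq_mul_inv, one_mul, neg_mul, Finset.sum_neg_distrib]
  ring

theorem tendsto_logGammaSeq {x : ℂ} (hx : x ∈ slitPlane) :
    Tendsto (logGammaSeq x) atTop (𝓝 (logGamma x)) := by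
  have h1 := (summable_logGamma_terms x).hasSum.tendsto_sum_nat
  have h2 : Tendsto (fun n : ℕ => ((harmonic n - Real.log n : ℝ) : ℂ)) atTop
      (𝓝 Real.eulerMascheroniConstant) :=
    (continuous_ofReal.tendsto _).comp Real.tendsto_harmonic_sub_log
  have h3 := ((h2.const_mul (-x)).sub_const (log x)).add h1
  rw [logGamma]
  convert h3.congr fun n => (logGammaSeq_eq hx n).symm using 2
  ring

theorem logGamma_add_one {x : ℂ} (hx : x ∈ slitPlane) :
    logGamma (x + 1) = logGamma x + log x := by
  have hx1 : x + 1 ∈ slitPlane := by simpa using add_natCast_mem_slitPlane hx 1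
  refine tendsto_nhds_unique (tendsto_logGammaSeq hx1) ?_
  -- This is the whole discrepancy in the functional equation at stage `n` of Gauss's product.
  have h0 : Tendsto (fun n : ℕ => log (1 + (x + 1) / n)) atTop (𝓝 0) := by
    have h1 : Tendsto (fun n : ℕ => 1 + (x + 1) / (n : ℂ)) atTop (𝓝 1) := by
      simpa using (tendsto_const_div_atTop_nhds_zero_nat (x + 1)).const_add 1
    simpa using h1.clog one_mem_slitPlane
  have h2 := ((tendsto_logGammaSeq hx).add_const (log x)).sub h0
  rw [sub_zero] at h2
  refine h2.congr' ?_
  filter_upwards [eventually_gt_atTop 0] with n hn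
  have h3 := log_one_add_div (x := x + 1) (r := n) (by positivity)
    (by simpa using slitPlane_ne_zero (add_natCast_mem_slitPlane hx1 n))
  rw [logGammaSeq, logGammaSeq, Finset.sum_range_succ', Finset.sum_range_succ _ n]
  have h4 : ∀ k : ℕ, log (x + (k + 1 : ℕ)) = log (x + 1 + k) := fun k => by
    congr 1
    push_cast
    ring
  simp only [h4, Nat.cast_zero, add_zero]
  rw [ofReal_natCast] at h3
  rw [h3]
  ring

theorem exp_logGamma {x : ℂ} (hx : x ∈ slitPlane) : exp (logGamma x) = Gamma x := by
  refine tendsto_nhds_unique ((tendsto_logGammaSeq hx).cexp) ?_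
  refine (GammaSeq_tendsto_Gamma x).congr' ?_
  filter_upwards [eventually_gt_atTop 0] with n hn
  have hn' : (n : ℂ) ≠ 0 := by exact_mod_cast hn.ne'
  rw [logGammaSeq, exp_sub, exp_add, exp_sum, GammaSeq, cpow_def_of_ne_zero hn',
    ← natCast_log, mul_comm x, ← ofReal_exp, Real.exp_log (by positivity)]
  congr 1
  refine Finset.prod_congr rfl fun k _ => ?_
  rw [exp_log (slitPlane_ne_zero (add_natCast_mem_slitPlane hx k))]

theorem isLogGammaBranch_logGamma : IsLogGammaBranch logGamma where
  analytic := DifferentiableOn.analyticOnNhd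
    (fun _ hx => (differentiableAt_logGamma hx).differentiableWithinAt) isOpen_slitPlane
  exp_eq _ hx := exp_logGamma hx
  real x hx := by
    have h := (continuous_im.tendsto _).comp
      (tendsto_logGammaSeq (x := x) (ofReal_mem_slitPlane.2 hx))
    refine tendsto_nhds_unique h (tendsto_const_nhds.congr fun n => ?_)
    have h1 : ∀ k : ℕ, log ((x : ℂ) + k) = (Real.log (x + k) : ℂ) := fun k => by
      rw [ofReal_log (by positivity)]
      simp
    simp only [Function.comp, logGammaSeq, h1]
    rw [← ofReal_mul, ← ofReal_add, ← ofReal_sum, ← ofReal_sub, ofReal_im]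

theorem logGamma_add_natCast {x : ℂ} (hx : x ∈ slitPlane) (n : ℕ) :
    logGamma (x + n) = logGamma x + ∑ k ∈ Finset.range n, log (x + k) := by
  induction n with
  | zero => simp
  | succ n ih =>
    rw [Nat.cast_succ, ← add_assoc, logGamma_add_one (add_natCast_mem_slitPlane hx n), ih,
      Finset.sum_range_succ, add_assoc]

theorem tendsto_log_factorial_sub :
    Tendsto (fun n : ℕ => Real.log n.factorial - (n + 1 / 2) * Real.log n + n) atTop
      (𝓝 (Real.log (2 * Real.pi) / 2)) := by
  have h := (Stirling.tendsto_stirlingSeq_sqrt_pi.log (by positivity)).add_const (Real.log 2 / 2)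
  rw [Real.log_sqrt Real.pi_pos.le, ← add_div, add_comm (Real.log _),
    ← Real.log_mul (by norm_num) Real.pi_ne_zero] at h
  refine h.congr' ?_
  filter_upwards [eventually_gt_atTop 0] with n hn
  have hn' : (n : ℝ) ≠ 0 := by exact_mod_cast hn.ne'
  rw [Stirling.log_stirlingSeq_formula, Real.log_mul (by norm_num) hn',
    Real.log_div hn' (Real.exp_ne_zero _), Real.log_exp]
  ring

/-- Stirling's formula for the branch `logGamma`, along translates by natural numbers. -/
theorem tendsto_logGamma_sub_stirling {x : ℂ} (hx : x ∈ slitPlane) :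
    Tendsto (fun n : ℕ => logGamma (x + n) -
      ((Real.log (2 * Real.pi) : ℂ) / 2 - (x + n) + ((x + n) - 1 / 2) * log (x + n)))
      atTop (𝓝 0) := by
  have h1 := (tendsto_logGammaSeq hx).const_sub (logGamma x)
  have h2 := (continuous_ofReal.tendsto _).comp tendsto_log_factorial_sub
  have h0 : Tendsto (fun n : ℕ => log (1 + x / n)) atTop (𝓝 0) := by
    have h1 : Tendsto (fun n : ℕ => 1 + x / (n : ℂ)) atTop (𝓝 1) := by
      simpa using (tendsto_const_div_atTop_nhds_zero_nat x).const_add 1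
    simpa using h1.clog one_mem_slitPlane
  have h3 : Tendsto (fun n : ℕ => (n : ℂ) * log (1 + x / n)) atTop (𝓝 x) := by
    refine tendsto_nat_mul_log_one_add_of_tendsto ?_
    refine tendsto_const_nhds.congr' ?_
    filter_upwards [eventually_gt_atTop 0] with n hn
    have hn' : (n : ℂ) ≠ 0 := by exact_mod_cast hn.ne'
    field_simp
  -- After `log (x + n) = log n + log (1 + x/n)`, the terms in `log n` cancel against Stirling's
  -- formula for `n!`. The coefficient `-(x + n + 1/2)` of `log (1 + x/n)` has an extra `-1` because
  -- Gauss's product includes the factor `x + n`.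
  have h4 := (((h1.add h2).sub (h0.const_mul (x + 1 / 2))).sub h3).add_const
    (x - (Real.log (2 * Real.pi) : ℂ) / 2)
  have hlim : logGamma x - logGamma x + ((Real.log (2 * Real.pi) / 2 : ℝ) : ℂ) -
      (x + 1 / 2) * 0 - x + (x - (Real.log (2 * Real.pi) : ℂ) / 2) = 0 := by
    push_cast
    ring
  rw [hlim] at h4
  refine h4.congr' ?_
  filter_upwards [eventually_gt_atTop 0] with n hn
  have h5 := log_one_add_div (x := x) (r := n) (by positivity)
    (by simpa using slitPlane_ne_zero (add_natCast_mem_slitPlane hx n))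
  rw [ofReal_natCast] at h5
  rw [logGamma_add_natCast hx, logGammaSeq, Finset.sum_range_succ]
  simp only [Function.comp]
  push_cast at h5 ⊢
  rw [h5]
  ring

/-! ### Euler–Maclaurin summation on the unit interval -/

theorem integral_bernoulliFun_mul_of_hasDerivAt (j : ℕ) {f f' : ℝ → ℂ}
    (hf : ∀ s ∈ Icc (0 : ℝ) 1, HasDerivAt f (f' s) s) (hf' : ContinuousOn f' (Icc 0 1)) :
    ∫ s in (0 : ℝ)..1, ((bernoulliFun j s / j.factorial : ℝ) : ℂ) * f s =
      ((bernoulliFun (j + 1) 1 / (j + 1).factorial : ℝ) : ℂ) * f 1 -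
        ((bernoulliFun (j + 1) 0 / (j + 1).factorial : ℝ) : ℂ) * f 0 -
      ∫ s in (0 : ℝ)..1, ((bernoulliFun (j + 1) s / (j + 1).factorial : ℝ) : ℂ) * f' s := by
  have hb : ∀ s : ℝ, HasDerivAt
      (fun s : ℝ => ((bernoulliFun (j + 1) s / (j + 1).factorial : ℝ) : ℂ))
      ((bernoulliFun j s / j.factorial : ℝ) : ℂ) s := by
    intro s
    refine HasDerivAt.ofReal_comp ?_
    refine ((hasDerivAt_bernoulliFun (j + 1) s).div_const _).congr_deriv ?_
    rw [Nat.factorial_succ, Nat.add_sub_cancel]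
    push_cast
    field_simp
  rw [← uIcc_of_le zero_le_one] at hf hf'
  have hc : Continuous fun s : ℝ => ((bernoulliFun j s / j.factorial : ℝ) : ℂ) :=
    continuous_ofReal.comp ((continuous_bernoulliFun (k := j)).div_const _)
  have h := intervalIntegral.integral_mul_deriv_eq_deriv_mul (a := 0) (b := 1)
    (fun s _ => hb s) hf (hc.intervalIntegrable _ _) hf'.intervalIntegrable
  rw [h]
  ring

theorem bernoulliFun_endpoint_zero {j : ℕ} (hj : Odd j) (h1 : 1 < j) :
    bernoulliFun j 1 = 0 ∧ bernoulliFun j 0 = 0 := by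
  have h0 : bernoulliFun j 0 = 0 := by
    rw [bernoulliFun_eval_zero, bernoulli_eq_zero_of_odd hj h1, Rat.cast_zero]
  exact ⟨by rw [bernoulliFun_endpoints_eq_of_ne_one h1.ne', h0], h0⟩

/-- The Euler–Maclaurin formula on the unit interval. -/
theorem integral_eq_eulerMaclaurin (g : ℕ → ℝ → ℂ)
    (hg : ∀ j, ∀ s ∈ Icc (0 : ℝ) 1, HasDerivAt (g j) (g (j + 1) s) s) (M : ℕ) :
    ∫ s in (0 : ℝ)..1, g 0 s = (g 0 0 + g 0 1) / 2 -
      ∑ k ∈ Finset.Icc 1 (M + 1), (bernoulli (2 * k) : ℂ) / ((2 * k).factorial : ℂ) *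
        (g (2 * k - 1) 1 - g (2 * k - 1) 0) +
      ∫ s in (0 : ℝ)..1,
        ((bernoulliFun (2 * (M + 1)) s / (2 * (M + 1)).factorial : ℝ) : ℂ) * g (2 * (M + 1)) s := by
  have hc : ∀ j, ContinuousOn (g j) (Icc 0 1) := fun j s hs =>
    (hg j s hs).continuousAt.continuousWithinAt
  have step := fun j i => integral_bernoulliFun_mul_of_hasDerivAt j (hg i) (hc (i + 1))
  have heven : ∀ k : ℕ, 1 ≤ k → bernoulliFun (2 * k) 1 = bernoulli (2 * k) ∧
      bernoulliFun (2 * k) 0 = bernoulli (2 * k) := fun k hk =>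
    ⟨by rw [bernoulliFun_endpoints_eq_of_ne_one (by omega), bernoulliFun_eval_zero],
      bernoulliFun_eval_zero _⟩
  induction M with
  | zero =>
    have h0 := step 0 0
    have h1 := step 1 1
    obtain ⟨e1, e0⟩ := heven 1 le_rfl
    -- The first Bernoulli polynomial is the only one whose endpoint values differ; it yields the
    -- trapezoidal term.
    have hB1 : (bernoulliFun 1 1 = 1 / 2) ∧ bernoulliFun 1 0 = -(1 / 2) := by
      constructor <;> rw [bernoulliFun_one] <;> norm_num
    simp only [zero_add, mul_one, Nat.reduceAdd, hB1, bernoulliFun_zero, Nat.factorial_zero,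
      Nat.factorial_one, Nat.cast_one, div_one, ofReal_one, one_mul] at h0 h1 e1 e0 ⊢
    rw [e1, e0] at h1
    rw [h0, h1, Finset.Icc_self, Finset.sum_singleton]
    push_cast
    ring
  | succ M ih =>
    rw [ih, Finset.sum_Icc_succ_top (b := M + 1) (by omega)]
    -- Two integrations by parts advance `M` by one; the boundary terms of odd index vanish.
    have h0 := step (2 * (M + 1)) (2 * (M + 1))
    have h1 := step (2 * (M + 1) + 1) (2 * (M + 1) + 1)
    obtain ⟨o1, o0⟩ := bernoulliFun_endpoint_zero (j := 2 * (M + 1) + 1) ⟨M + 1, rfl⟩ (by omega)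
    obtain ⟨e1, e0⟩ := heven (M + 2) (by omega)
    rw [o1, o0] at h0
    rw [show 2 * (M + 1) + 1 + 1 = 2 * (M + 1 + 1) by ring] at h1
    rw [show 2 * (M + 2) = 2 * (M + 1 + 1) by ring] at e1 e0
    rw [e1, e0] at h1
    rw [h0, h1, show 2 * (M + 1 + 1) - 1 = 2 * (M + 1) + 1 by omega]
    push_cast
    ring

/-! ### The kernel with its pole at the origin removed -/

/-- The `j`-th derivative of `1 / (e^w - 1) - 1 / w`. -/
def polylogRegular (j : ℕ) (w : ℂ) : ℂ :=
  (-1) ^ j * (polylogNeg j (exp (-w)) - (j.factorial : ℂ) / w ^ (j + 1))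

theorem hasDerivAt_polylogRegular (j : ℕ) {w : ℂ} (hw : w ≠ 0) (he : exp (-w) ≠ 1) :
    HasDerivAt (polylogRegular j) (polylogRegular (j + 1) w) w := by
  have h1 := hasDerivAt_polylogNeg_exp j he
  have h2 : HasDerivAt (fun w : ℂ => (j.factorial : ℂ) / w ^ (j + 1))
      (-((j + 1).factorial : ℂ) / w ^ (j + 2)) w := by
    refine ((hasDerivAt_const w (j.factorial : ℂ)).div (hasDerivAt_pow (j + 1) w)
      (pow_ne_zero _ hw)).congr_deriv ?_
    rw [Nat.factorial_succ]
    push_cast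
    field_simp
    ring
  refine ((h1.sub h2).const_mul ((-1) ^ j)).congr_deriv ?_
  rw [polylogRegular]
  ring

/-- The analytic continuation of `1 / (e^w - 1) - 1 / w` to the origin. -/
def regularKernel (w : ℂ) : ℂ := -dslope (dslope exp 0) 0 w / dslope exp 0 w

theorem dslope_exp_ne_zero {w : ℂ} (h : w = 0 ∨ exp (-w) ≠ 1) : dslope exp 0 w ≠ 0 := by
  by_cases hw : w = 0
  · simp [hw]
  · rw [dslope_of_ne _ hw, slope_def_field, exp_zero]
    have h1 := h.resolve_left hw
    have h2 : exp w ≠ 1 := fun h2 => h1 (by rw [exp_neg, h2, inv_one])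
    exact div_ne_zero (sub_ne_zero.2 h2) (by simpa using hw)

theorem differentiable_dslope_zero {f : ℂ → ℂ} (hf : Differentiable ℂ f) :
    Differentiable ℂ (dslope f 0) := by
  rw [← differentiableOn_univ] at hf ⊢
  exact (differentiableOn_dslope univ_mem).2 hf

theorem analyticOnNhd_regularKernel : AnalyticOnNhd ℂ regularKernel {w | dslope exp 0 w ≠ 0} := by
  have h1 := differentiable_dslope_zero differentiable_exp
  have h2 := differentiable_dslope_zero h1
  refine DifferentiableOn.analyticOnNhd (fun w hw => ?_) (isOpen_ne_fun h1.continuous continuous_const)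
  exact ((h2 w).neg.div (h1 w) hw).differentiableWithinAt

/-- The two difference quotients are `(e^w - 1)/w` and `(e^w - 1 - w)/w^2`; minus their ratio is
`1/(e^w - 1) - 1/w`. -/
theorem regularKernel_eq {w : ℂ} (hw : w ≠ 0) (he : exp (-w) ≠ 1) :
    regularKernel w = polylogRegular 0 w := by
  have h0 := dslope_exp_ne_zero (Or.inr he)
  have h1 : exp w - 1 ≠ 0 := by
    refine sub_ne_zero.2 fun h2 => he (by rw [exp_neg, h2, inv_one])
  have h2 := exp_ne_zero w
  rw [regularKernel, dslope_of_ne _ hw, slope_def_field, dslope_of_ne _ hw, slope_def_field,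
    dslope_same, polylogRegular, polylogNeg, exp_neg]
  have h3 : 1 - (exp w)⁻¹ ≠ 0 := by
    rw [← exp_neg]
    exact sub_ne_zero.2 he.symm
  simp only [Complex.deriv_exp, exp_zero, sub_zero, pow_zero, one_mul, Nat.factorial_zero,
    Nat.cast_one, zero_add, pow_one]
  have h4 : (exp w)⁻¹ / (1 - (exp w)⁻¹) = 1 / (exp w - 1) := by
    rw [div_eq_div_iff h3 h1]
    field_simp
  rw [h4]
  field_simp
  ring

theorem isOpen_regular : IsOpen {w : ℂ | w ≠ 0 ∧ exp (-w) ≠ 1} :=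
  isOpen_ne.inter (isOpen_ne_fun (by fun_prop) continuous_const)

theorem iterate_deriv_regularKernel (j : ℕ) {w : ℂ} (hw : w ≠ 0) (he : exp (-w) ≠ 1) :
    deriv^[j] regularKernel w = polylogRegular j w := by
  induction j generalizing w with
  | zero => exact regularKernel_eq hw he
  | succ j ih =>
    rw [Function.iterate_succ_apply']
    have : deriv^[j] regularKernel =ᶠ[𝓝 w] polylogRegular j := by
      filter_upwards [isOpen_regular.mem_nhds ⟨hw, he⟩] with z hz using ih hz.1 hz.2
    rw [this.deriv_eq, (hasDerivAt_polylogRegular j hw he).deriv]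

/-! ### Uniform bounds on the region swept out by the rays -/

/-- A region that contains all rays `y + β ℝ_{≥ 0}` with `|Im y| ≤ π` and `Re y ≥ -Y`. -/
def rayRegion (Y τ : ℝ) : Set ℂ := {w | -Y ≤ w.re ∧ |w.im| ≤ Real.pi + (w.re + Y) * τ}

/-- On the imaginary axis the region reaches height `π + Yτ < 2π`, so it misses every nonzero point
of `2πiℤ`. -/
theorem exp_neg_ne_one_of_mem_rayRegion {Y τ : ℝ} (hτ : Y * τ < Real.pi) {w : ℂ}
    (hw : w ∈ rayRegion Y τ) (h0 : w ≠ 0) : exp (-w) ≠ 1 := by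
  intro h
  obtain ⟨n, hn⟩ := exp_eq_one_iff.1 h
  have hre : w.re = 0 := by
    have := congrArg re hn
    simpa using this
  have him : w.im = -n * (2 * Real.pi) := by
    have := congrArg im hn
    simp at this
    linarith
  have hle := hw.2
  rw [hre, him, zero_add, abs_mul, abs_neg, abs_of_pos Real.two_pi_pos] at hle
  have hlt : |(n : ℝ)| < 1 := by
    by_contra! hge
    nlinarith [Real.pi_pos]
  have hn0 : n = 0 := by
    have : |n| < 1 := by exact_mod_cast hlt
    exact Int.abs_lt_one_iff.1 this
  refine h0 (Complex.ext hre ?_)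
  rw [him, hn0]
  simp

theorem isCompact_rayRegion_inter (Y τ x : ℝ) :
    IsCompact (rayRegion Y τ ∩ {w | w.re ≤ x}) := by
  refine Metric.isCompact_of_isClosed_isBounded ?_ ?_
  · refine IsClosed.inter (IsClosed.inter ?_ ?_) ?_
    · exact isClosed_le continuous_const continuous_re
    · exact isClosed_le (continuous_abs.comp continuous_im)
        (((continuous_re.add continuous_const).mul continuous_const).const_add Real.pi)
    · exact isClosed_le continuous_re continuous_const
  · refine isBounded_iff_forall_norm_le.2
      ⟨max |x| |Y| + (Real.pi + (|x| + |Y|) * |τ|), fun w hw => ?_⟩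
    obtain ⟨⟨h1, h2⟩, h3⟩ := hw
    simp only [mem_ofPred_eq] at h3
    refine (norm_le_abs_re_add_abs_im w).trans (add_le_add ?_ (h2.trans ?_))
    · refine abs_le.2 ⟨?_, h3.trans ((le_abs_self x).trans (le_max_left _ _))⟩
      linarith [le_abs_self Y, le_max_right |x| |Y|]
    · have h4 : 0 ≤ w.re + Y := by linarith
      have h5 : w.re + Y ≤ |x| + |Y| := by linarith [le_abs_self Y, le_abs_self x]
      have h6 : (w.re + Y) * τ ≤ (w.re + Y) * |τ| := by
        gcongr
        exact le_abs_self τ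
      have h7 : (w.re + Y) * |τ| ≤ (|x| + |Y|) * |τ| := by gcongr
      linarith

/-- The truncated region is compact, and `regularKernel` fills in the origin, so its derivatives are
bounded by continuity. -/
theorem norm_polylogRegular_le_of_re_le (j : ℕ) {Y τ : ℝ} (hτ : Y * τ < Real.pi) (x : ℝ) :
    ∃ C : ℝ, 0 ≤ C ∧ ∀ w ∈ rayRegion Y τ, w ≠ 0 → w.re ≤ x → ‖polylogRegular j w‖ ≤ C := by
  have hsub : rayRegion Y τ ∩ {w | w.re ≤ x} ⊆ {w | dslope exp 0 w ≠ 0} := fun w hw =>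
    dslope_exp_ne_zero (or_iff_not_imp_left.2 (exp_neg_ne_one_of_mem_rayRegion hτ hw.1))
  obtain ⟨C, hC⟩ := (isCompact_rayRegion_inter Y τ x).exists_bound_of_continuousOn
    ((analyticOnNhd_regularKernel.iterated_deriv j).continuousOn.mono hsub)
  refine ⟨max C 0, le_max_right _ _, fun w hw h0 hx => ?_⟩
  rw [← iterate_deriv_regularKernel j h0 (exp_neg_ne_one_of_mem_rayRegion hτ hw h0)]
  exact (hC w ⟨hw, hx⟩).trans (le_max_left _ _)

theorem norm_polylogRegular_le_of_one_le_re (j : ℕ) :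
    ∃ C : ℝ, 0 ≤ C ∧ ∀ w : ℂ, 1 ≤ w.re →
      ‖polylogRegular j w‖ ≤ C * Real.exp (-w.re) + j.factorial / w.re ^ (j + 1) := by
  obtain ⟨C, hC, h⟩ := norm_polylogNeg_le j (c := 1 / 2) (by norm_num)
  refine ⟨C, hC, fun w hw => ?_⟩
  rw [polylogRegular, norm_mul, norm_pow, norm_neg, norm_one, one_pow, one_mul]
  refine (norm_sub_le _ _).trans (add_le_add ?_ ?_)
  · refine (h _ (half_le_norm_one_sub_exp hw)).trans_eq ?_
    rw [norm_exp, neg_re]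
  · rw [norm_div, norm_pow, norm_natCast]
    have : 0 < w.re := by linarith
    gcongr
    exact re_le_norm w

theorem norm_polylogRegular_le (j : ℕ) {Y τ : ℝ} (hτ : Y * τ < Real.pi) :
    ∃ C : ℝ, 0 ≤ C ∧ ∀ w ∈ rayRegion Y τ, w ≠ 0 → ‖polylogRegular j w‖ ≤ C := by
  obtain ⟨C₁, hC₁, h₁⟩ := norm_polylogRegular_le_of_re_le j hτ 1
  obtain ⟨C₂, hC₂, h₂⟩ := norm_polylogRegular_le_of_one_le_re j
  refine ⟨C₁ + (C₂ + j.factorial), by positivity, fun w hw h0 => ?_⟩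
  rcases le_total w.re 1 with h | h
  · refine (h₁ w hw h0 h).trans ?_
    linarith [(Nat.cast_nonneg j.factorial : (0 : ℝ) ≤ _)]
  · have h3 : C₂ * Real.exp (-w.re) ≤ C₂ * 1 := by
      gcongr
      exact Real.exp_le_one_iff.2 (by linarith)
    have h4 : (j.factorial : ℝ) / w.re ^ (j + 1) ≤ j.factorial :=
      div_le_self (Nat.cast_nonneg _) (one_le_pow₀ h)
    linarith [h₂ w h]

theorem norm_polylogRegular_succ_le (j : ℕ) {Y τ : ℝ} (hτ : Y * τ < Real.pi) :
    ∃ C : ℝ, 0 ≤ C ∧ ∀ w ∈ rayRegion Y τ, w ≠ 0 →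
      ‖polylogRegular (j + 1) w‖ ≤ C * (1 + w.re ^ 2)⁻¹ := by
  obtain ⟨C₁, hC₁, h₁⟩ := norm_polylogRegular_le_of_re_le (j + 1) hτ 1
  obtain ⟨C₂, hC₂, h₂⟩ := norm_polylogRegular_le_of_one_le_re (j + 1)
  -- The first summand bounds the part `Re w ≤ 1`, where `(Re w)^2 ≤ 1 + Y^2`. For `x = Re w ≥ 1`,
  -- both `e^{-x} (1 + x^2)` and `(1 + x^2) / x^(j + 2)` are at most 2; the latter needs order at
  -- least one.
  refine ⟨C₁ * (1 + (1 + Y ^ 2)) + (C₂ * 2 + (j + 1).factorial * 2), by positivity,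
    fun w hw h0 => ?_⟩
  have hpos : 0 < 1 + w.re ^ 2 := by positivity
  rw [← div_eq_mul_inv, le_div_iff₀ hpos]
  rcases le_total w.re 1 with h | h
  · have h3 : w.re ^ 2 ≤ 1 + Y ^ 2 := by
      have h4 := hw.1
      rcases le_total 0 w.re with h5 | h5 <;> nlinarith
    calc _ ≤ C₁ * (1 + (1 + Y ^ 2)) := by
          gcongr
          exact h₁ w hw h0 h
      _ ≤ _ := le_add_of_nonneg_right (by positivity)
  · have h3 : Real.exp (-w.re) * (1 + w.re ^ 2) ≤ 2 := by
      have h4 := Real.quadratic_le_exp_of_nonneg (by linarith : 0 ≤ w.re)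
      have h5 : Real.exp (-w.re) * Real.exp w.re = 1 := by rw [← Real.exp_add]; simp
      nlinarith [Real.exp_pos (-w.re)]
    have h4 : (1 + w.re ^ 2) / w.re ^ (j + 1 + 1) ≤ 2 := by
      rw [div_le_iff₀ (by positivity)]
      have h5 : w.re ^ 2 ≤ w.re ^ (j + 1 + 1) := pow_le_pow_right₀ h (by omega)
      nlinarith
    calc _ ≤ (C₂ * Real.exp (-w.re) + (j + 1).factorial / w.re ^ (j + 1 + 1)) *
            (1 + w.re ^ 2) := by
          gcongr
          exact h₂ w h
      _ = C₂ * (Real.exp (-w.re) * (1 + w.re ^ 2)) +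
            (j + 1).factorial * ((1 + w.re ^ 2) / w.re ^ (j + 1 + 1)) := by ring
      _ ≤ C₂ * 2 + (j + 1).factorial * 2 := by gcongr
      _ ≤ _ := le_add_of_nonneg_left (by positivity)

theorem tendsto_polylogRegular_ray (j : ℕ) {β : ℂ} (y : ℂ) (hβ : 0 < β.re) :
    Tendsto (fun t : ℝ => polylogRegular j (y + t * β)) atTop (𝓝 0) := by
  obtain ⟨C, hC, h⟩ := norm_polylogRegular_le_of_one_le_re j
  have hre : Tendsto (fun t : ℝ => (y + t * β).re) atTop atTop := by
    simpa using tendsto_atTop_add_const_left _ y.re (tendsto_id.atTop_mul_const hβ)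
  have h1 : Tendsto (fun x : ℝ => C * Real.exp (-x) + j.factorial / x ^ (j + 1)) atTop (𝓝 0) := by
    have h2 := (Real.tendsto_exp_neg_atTop_nhds_zero.const_mul C).add
      ((tendsto_pow_atTop (α := ℝ) (Nat.succ_ne_zero j)).const_div_atTop (j.factorial : ℝ))
    simpa using h2
  refine squeeze_zero_norm' ?_ (h1.comp hre)
  filter_upwards [hre.eventually_ge_atTop 1] with t ht using h _ ht

theorem add_mul_mem_rayRegion {Y τ : ℝ} (hτ0 : 0 ≤ τ) {β y : ℂ} (hβ : 0 < β.re)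
    (hβτ : |β.im| ≤ τ * β.re) (him : |y.im| ≤ Real.pi) (hre : -Y ≤ y.re) {s : ℝ} (hs : 0 ≤ s) :
    y + s * β ∈ rayRegion Y τ := by
  have h0 : 0 ≤ s * β.re := by positivity
  refine ⟨by simp; linarith, ?_⟩
  have h1 : (y + s * β).im = y.im + s * β.im := by simp
  have h2 : (y + s * β).re = y.re + s * β.re := by simp
  rw [h1, h2]
  refine (abs_add_le _ _).trans ?_
  rw [abs_mul, abs_of_nonneg hs]
  have h3 : s * |β.im| ≤ s * (τ * β.re) := by gcongr
  have h4 : 0 ≤ (y.re + Y) * τ := mul_nonneg (by linarith) hτ0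
  linarith

theorem div_mem_slitPlane {β y : ℂ} (hβ0 : β ≠ 0) (h : ∀ s : ℝ, 0 ≤ s → y + s * β ≠ 0) :
    y / β ∈ slitPlane := by
  rw [mem_slitPlane_iff]
  by_contra! hc
  have hx : y / β = ((y / β).re : ℂ) := Complex.ext rfl (by simpa using hc.2)
  refine h (-(y / β).re) (by linarith) ?_
  rw [ofReal_neg, ← hx]
  field_simp
  ring

/-! ### Telescoping the remainder along the ray -/

/-- The derivatives in `s` of `log (1 - e^{-(y + sβ)}) - log (y / β + s)`. -/
def eulerMaclaurinTower (β y : ℂ) : ℕ → ℝ → ℂ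
  | 0 => fun s => logOneSubExp β (y + s * β) - log (y / β + s)
  | j + 1 => fun s => β ^ (j + 1) * polylogRegular j (y + s * β)

theorem hasDerivAt_log_div_add {β y : ℂ} (hβ : 0 < β.re)
    (h0 : ∀ s : ℝ, 0 ≤ s → y + s * β ≠ 0) {s : ℝ} (hs : 0 ≤ s) :
    HasDerivAt (fun s : ℝ => log (y / β + s)) (β / (y + s * β)) s := by
  have hβ0 : β ≠ 0 := fun h => by simp [h] at hβ
  have hmem : y / β + s ∈ slitPlane := by
    have := div_mem_slitPlane (y := y + s * β) hβ0 fun t ht => by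
      have := h0 (s + t) (by linarith)
      rwa [ofReal_add, add_mul, ← add_assoc] at this
    rwa [add_div, mul_div_cancel_right₀ _ hβ0] at this
  have h1 : HasDerivAt (fun s : ℝ => y / β + s) 1 s :=
    (ofRealCLM.hasDerivAt (x := s)).const_add (y / β)
  refine (h1.clog_real hmem).congr_deriv ?_
  have h2 := slitPlane_ne_zero hmem
  have h3 := h0 s hs
  rw [div_eq_div_iff h2 h3]
  field_simp

theorem hasDerivAt_eulerMaclaurinTower {β y : ℂ} (hβ : 0 < β.re) (hy : y ∈ cutPlane β)
    (h0 : ∀ s : ℝ, 0 ≤ s → y + s * β ≠ 0) (j : ℕ) {s : ℝ} (hs : 0 ≤ s) :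
    HasDerivAt (eulerMaclaurinTower β y j) (eulerMaclaurinTower β y (j + 1) s) s := by
  have hray := hasDerivAt_add_mul y β s
  cases j with
  | zero =>
    have h1 := (hasDerivAt_logOneSubExp hβ (add_mul_mem_cutPlane hy hs)).scomp s hray
    refine (h1.sub (hasDerivAt_log_div_add hβ h0 hs)).congr_deriv ?_
    simp only [eulerMaclaurinTower, polylogRegular, smul_eq_mul, zero_add, pow_one, pow_zero,
      Nat.factorial_zero, Nat.cast_one]
    ring
  | succ j =>
    have h1 := (hasDerivAt_polylogRegular j (h0 s hs)
      (mem_cutPlane_iff.1 hy s hs)).scomp s hray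
    refine (h1.const_mul (β ^ (j + 1))).congr_deriv ?_
    simp only [eulerMaclaurinTower, smul_eq_mul]
    ring

theorem integral_eulerMaclaurinTower_zero {β y : ℂ} (hβ : 0 < β.re) (hy : y ∈ cutPlane β)
    (h0 : ∀ s : ℝ, 0 ≤ s → y + s * β ≠ 0) :
    ∫ s in (0 : ℝ)..1, eulerMaclaurinTower β y 0 s =
      (dilogExp β (y + β) / β - ((y / β + 1) * log (y / β + 1) - (y / β + 1))) -
      (dilogExp β y / β - (y / β * log (y / β) - y / β)) := by
  have hβ0 : β ≠ 0 := fun h => by simp [h] at hβ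
  have hd : ∀ s ∈ uIcc (0 : ℝ) 1, HasDerivAt (fun s : ℝ => dilogExp β (y + s * β) / β -
      ((y / β + s) * log (y / β + s) - (y / β + s))) (eulerMaclaurinTower β y 0 s) s := by
    intro s hs
    rw [uIcc_of_le zero_le_one] at hs
    have hray := hasDerivAt_add_mul y β s
    have h1 := (hasDerivAt_dilogExp hβ (add_mul_mem_cutPlane hy hs.1)).scomp s hray
    have h2 : HasDerivAt (fun s : ℝ => y / β + s) 1 s :=
      (ofRealCLM.hasDerivAt (x := s)).const_add (y / β)
    refine ((h1.div_const β).sub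
      ((h2.mul (hasDerivAt_log_div_add hβ h0 hs.1)).sub h2)).congr_deriv ?_
    have h3 := h0 s hs.1
    have h4 : (y / β + s) * (β / (y + s * β)) = 1 := by
      field_simp
      rw [mul_comm β, div_self h3]
    rw [h4]
    simp only [eulerMaclaurinTower, smul_eq_mul]
    rw [mul_div_cancel_left₀ _ hβ0]
    ring
  have hc : ContinuousOn (eulerMaclaurinTower β y 0) (uIcc 0 1) := by
    intro s hs
    rw [uIcc_of_le zero_le_one] at hs
    exact (hasDerivAt_eulerMaclaurinTower hβ hy h0 0 hs.1).continuousAt.continuousWithinAt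
  rw [intervalIntegral.integral_eq_sub_of_hasDerivAt hd hc.intervalIntegrable]
  simp

theorem correction_eq_sum_tower (β y : ℂ) (M : ℕ) (s : ℝ) :
    ∑ k ∈ Finset.Icc 1 M, (bernoulli (2 * k) : ℂ) * β ^ (2 * k - 1) / ((2 * k).factorial : ℂ) *
        (polylogNeg (2 * k - 2) (exp (-(y + s * β)))
          - ((2 * k - 2).factorial : ℂ) / (y + s * β) ^ (2 * k - 1)) =
      ∑ k ∈ Finset.Icc 1 M, (bernoulli (2 * k) : ℂ) / ((2 * k).factorial : ℂ) *
        eulerMaclaurinTower β y (2 * k - 1) s := by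
  refine Finset.sum_congr rfl fun k hk => ?_
  obtain ⟨m, rfl⟩ := Nat.exists_eq_add_of_le (Finset.mem_Icc.1 hk).1
  have e1 : 2 * (1 + m) - 1 = 2 * m + 1 := by omega
  have e2 : 2 * (1 + m) - 2 = 2 * m := by omega
  simp only [e1, e2, eulerMaclaurinTower, polylogRegular, pow_mul, neg_one_sq, one_pow, one_mul]
  ring

/-- One step of the telescoping: the remainder over a unit interval. -/
theorem remainder_sub_remainder_add {β y : ℂ} (hβ : 0 < β.re) (hy : y ∈ cutPlane β)
    (h0 : ∀ s : ℝ, 0 ≤ s → y + s * β ≠ 0)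
    (M : ℕ) :
    (logQPoch β y - truncatedSeries (M + 1) β y) -
      (logQPoch β (y + β) - truncatedSeries (M + 1) β (y + β)) =
      -∫ s in (0 : ℝ)..1, ((bernoulliFun (2 * (M + 1)) s / (2 * (M + 1)).factorial : ℝ) : ℂ) *
        eulerMaclaurinTower β y (2 * (M + 1)) s := by
  have hβ0 : β ≠ 0 := fun h => by simp [h] at hβ
  have hx := div_mem_slitPlane hβ0 h0
  have hem := integral_eq_eulerMaclaurin (eulerMaclaurinTower β y)
    (fun j s hs => hasDerivAt_eulerMaclaurinTower hβ hy h0 j hs.1) M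
  rw [integral_eulerMaclaurinTower_zero hβ hy h0] at hem
  simp only [mul_sub, Finset.sum_sub_distrib] at hem
  have hs0 := correction_eq_sum_tower β y (M + 1) 0
  have hs1 := correction_eq_sum_tower β y (M + 1) 1
  simp only [ofReal_zero, zero_mul, add_zero, ofReal_one, one_mul] at hs0 hs1
  have hdiv : (y + β) / β = y / β + 1 := by rw [add_div, div_self hβ0]
  -- The two functional equations contribute `log (1 - e^{-y})` and `-log (y/β)`, which add up to
  -- the value of the tower at `j = 0`, `s = 0`.
  rw [truncatedSeries, truncatedSeries, hdiv, logGamma_add_one hx, logQPoch_eq_add hβ hy,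
    hs0, hs1]
  simp only [eulerMaclaurinTower, ofReal_zero, zero_mul, add_zero, ofReal_one, one_mul] at hem ⊢
  linear_combination -hem

/-- Stirling's formula cancels the elementary terms against `logGamma`; every other term decays
separately. This fixes the constant `log (2π) / 2`. -/
theorem tendsto_remainder_ray {β y : ℂ} (hβ : 0 < β.re) (hy : y ∈ cutPlane β)
    (h0 : ∀ s : ℝ, 0 ≤ s → y + s * β ≠ 0)
    (M : ℕ) :
    Tendsto (fun n : ℕ => logQPoch β (y + n * β) - truncatedSeries M β (y + n * β)) atTop
      (𝓝 0) := by
  have hβ0 : β ≠ 0 := fun h => by simp [h] at hβ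
  have hx := div_mem_slitPlane hβ0 h0
  have hcast : Tendsto (fun n : ℕ => (n : ℝ)) atTop atTop := tendsto_natCast_atTop_atTop
  have h1 := tendsto_logQPoch_ray β y
  have h2 := (tendsto_dilogExp_ray hβ hy).comp hcast
  have h3 := (tendsto_logOneSubExp_ray hβ hy).comp hcast
  have h4 := tendsto_logGamma_sub_stirling hx
  have h5 : Tendsto (fun n : ℕ => ∑ k ∈ Finset.Icc 1 M,
      (bernoulli (2 * k) : ℂ) / ((2 * k).factorial : ℂ) *
        eulerMaclaurinTower β y (2 * k - 1) n) atTop (𝓝 0) := by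
    rw [← Finset.sum_const_zero (s := Finset.Icc 1 M)]
    refine tendsto_finsetSum _ fun k hk => ?_
    obtain ⟨m, rfl⟩ := Nat.exists_eq_add_of_le (Finset.mem_Icc.1 hk).1
    have e1 : 2 * (1 + m) - 1 = 2 * m + 1 := by omega
    simp only [e1, eulerMaclaurinTower, ofReal_natCast]
    have := (((tendsto_polylogRegular_ray (2 * m) y hβ).comp hcast).const_mul
      (β ^ (2 * m + 1))).const_mul
        ((bernoulli (2 * (1 + m)) : ℂ) / ((2 * (1 + m)).factorial : ℂ))
    simpa only [mul_zero, Function.comp_def, ofReal_natCast] using this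
  have h6 := (((h1.add (h2.div_const β)).sub (h3.div_const 2)).add h4).add h5
  simp only [add_zero, zero_div, sub_zero] at h6
  refine h6.congr fun n => ?_
  have hdiv : (y + n * β) / β = y / β + n := by rw [add_div, mul_div_cancel_right₀ _ hβ0]
  have hs := correction_eq_sum_tower β y M n
  rw [ofReal_natCast] at hs
  rw [truncatedSeries, hdiv, hs]
  simp only [Function.comp, ofReal_natCast]
  ring

theorem exists_bound_bernoulliFun (j : ℕ) :
    ∃ B : ℝ, 0 ≤ B ∧ ∀ s ∈ Icc (0 : ℝ) 1, ‖((bernoulliFun j s / j.factorial : ℝ) : ℂ)‖ ≤ B := by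
  obtain ⟨B, hB⟩ := isCompact_Icc.exists_bound_of_continuousOn (s := Icc (0 : ℝ) 1)
    (f := fun s : ℝ => ((bernoulliFun j s / j.factorial : ℝ) : ℂ))
    (continuous_ofReal.comp ((continuous_bernoulliFun (k := j)).div_const _)).continuousOn
  exact ⟨max B 0, le_max_right _ _, fun s hs => (hB s hs).trans (le_max_left _ _)⟩

/-- The majorant `1/(1 + x^2)` is integrated exactly, so that the bounds for successive steps
telescope. -/
theorem norm_remainder_step_le (M : ℕ) {Y τ : ℝ} (hτ : Y * τ < Real.pi) :
    ∃ A : ℝ, 0 ≤ A ∧ ∀ β y : ℂ, 0 < β.re →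
      (∀ s : ℝ, 0 ≤ s → y + s * β ∈ rayRegion Y τ ∧ y + s * β ≠ 0) →
      ‖(logQPoch β y - truncatedSeries (M + 1) β y) -
        (logQPoch β (y + β) - truncatedSeries (M + 1) β (y + β))‖ ≤
      A * ‖β‖ ^ (2 * M + 2) / β.re * (Real.arctan (y.re + β.re) - Real.arctan y.re) := by
  obtain ⟨B, hB, hBle⟩ := exists_bound_bernoulliFun (2 * (M + 1))
  obtain ⟨C, hC, hCle⟩ := norm_polylogRegular_succ_le (2 * M) hτ
  refine ⟨B * C, by positivity, fun β y hβ h => ?_⟩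
  have h0 := fun s hs => (h s hs).2
  have hy : y ∈ cutPlane β := mem_cutPlane_iff.2 fun s hs =>
    exp_neg_ne_one_of_mem_rayRegion hτ (h s hs).1 (h s hs).2
  rw [remainder_sub_remainder_add hβ hy h0, norm_neg]
  have hint : ∫ s in (0 : ℝ)..1, (1 + (y.re + s * β.re) ^ 2)⁻¹ * β.re =
      Real.arctan (y.re + β.re) - Real.arctan y.re := by
    have hd : ∀ s ∈ uIcc (0 : ℝ) 1, HasDerivAt (fun s : ℝ => Real.arctan (y.re + s * β.re))
        ((1 + (y.re + s * β.re) ^ 2)⁻¹ * β.re) s := fun s _ => by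
      have := (((hasDerivAt_id s).mul_const β.re).const_add y.re).arctan
      refine this.congr_deriv ?_
      simp
    rw [intervalIntegral.integral_eq_sub_of_hasDerivAt hd]
    · simp
    · refine Continuous.intervalIntegrable ?_ _ _
      refine Continuous.mul (Continuous.inv₀ (by fun_prop) fun s => ?_) continuous_const
      positivity
  rw [← hint, ← intervalIntegral.integral_const_mul]
  refine intervalIntegral.norm_integral_le_of_norm_le zero_le_one ?_ ?_
  · refine Eventually.of_forall fun s hs => ?_
    have hs' : s ∈ Icc (0 : ℝ) 1 := ⟨hs.1.le, hs.2⟩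
    have h3 := hCle _ (h s hs'.1).1 (h s hs'.1).2
    have hre : (y + s * β).re = y.re + s * β.re := by simp
    rw [hre] at h3
    rw [norm_mul]
    change _ * ‖β ^ (2 * M + 1 + 1) * polylogRegular (2 * M + 1) (y + s * β)‖ ≤ _
    rw [norm_mul, norm_pow]
    calc _ ≤ B * (‖β‖ ^ (2 * M + 1 + 1) * (C * (1 + (y.re + s * β.re) ^ 2)⁻¹)) := by
          gcongr
          exact hBle s hs'
      _ = _ := by
        field_simp
  · refine Continuous.intervalIntegrable ?_ _ _
    refine continuous_const.mul (Continuous.mul (Continuous.inv₀ (by fun_prop) fun s => ?_)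
      continuous_const)
    positivity

theorem norm_remainder_succ_le (M : ℕ) {Y τ : ℝ} (hτ : Y * τ < Real.pi) (hτ0 : 0 ≤ τ) :
    ∃ D : ℝ, 0 ≤ D ∧ ∀ β y : ℂ, 0 < β.re → |β.im| ≤ τ * β.re →
      (∀ s : ℝ, 0 ≤ s → y + s * β ∈ rayRegion Y τ ∧ y + s * β ≠ 0) →
      ‖logQPoch β y - truncatedSeries (M + 1) β y‖ ≤ D * ‖β‖ ^ (2 * M + 1) := by
  obtain ⟨A, hA, hAle⟩ := norm_remainder_step_le M hτ
  -- The factor `π` is the total variation of `arctan`. The factor `1 + τ` bounds `‖β‖ / Re β`, at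
  -- the cost of one power of `‖β‖`.
  refine ⟨A * (1 + τ) * Real.pi, by have := Real.pi_pos; positivity, fun β y hβ hβτ h => ?_⟩
  have h0 := fun s hs => (h s hs).2
  have hy : y ∈ cutPlane β := mem_cutPlane_iff.2 fun s hs =>
    exp_neg_ne_one_of_mem_rayRegion hτ (h s hs).1 (h s hs).2
  set r : ℂ → ℂ := fun y => logQPoch β y - truncatedSeries (M + 1) β y with hr
  set K := A * ‖β‖ ^ (2 * M + 2) / β.re with hK
  have hK0 : 0 ≤ K := by positivity
  have htel : ∀ n : ℕ, ‖r y - r (y + n * β)‖ ≤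
      K * (Real.arctan (y.re + n * β.re) - Real.arctan y.re) := by
    intro n
    induction n with
    | zero => simp
    | succ n ih =>
      have hstep := hAle β (y + n * β) hβ fun s hs => by
        have := h (n + s) (by positivity)
        rwa [ofReal_add, add_mul, ← add_assoc, ofReal_natCast] at this
      have e1 : y + n * β + β = y + (n + 1 : ℕ) * β := by
        push_cast
        ring
      have e2 : (y + n * β).re = y.re + n * β.re := by simp
      have e3 : y.re + n * β.re + β.re = y.re + (n + 1 : ℕ) * β.re := by
        push_cast
        ring
      rw [e1, e2, e3] at hstep
      calc _ = ‖(r y - r (y + n * β)) + (r (y + n * β) - r (y + (n + 1 : ℕ) * β))‖ := by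
            congr 1
            ring
        _ ≤ _ := (norm_add_le _ _).trans (add_le_add ih hstep)
        _ = _ := by ring
  have hbound : ∀ n : ℕ, ‖r y - r (y + n * β)‖ ≤ K * Real.pi := fun n => by
    refine (htel n).trans ?_
    gcongr
    linarith [Real.arctan_lt_pi_div_two (y.re + n * β.re), Real.neg_pi_div_two_lt_arctan y.re]
  have hlim : Tendsto (fun n : ℕ => ‖r y - r (y + n * β)‖) atTop (𝓝 ‖r y‖) := by
    simpa using ((tendsto_remainder_ray hβ hy h0 (M + 1)).const_sub (r y)).norm
  refine (le_of_tendsto' hlim hbound).trans ?_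
  have hnorm : ‖β‖ ≤ (1 + τ) * β.re := by
    have := norm_le_abs_re_add_abs_im β
    rw [abs_of_pos hβ] at this
    linarith
  have hKle : K ≤ A * (1 + τ) * ‖β‖ ^ (2 * M + 1) := by
    rw [hK, div_le_iff₀ hβ]
    calc _ = A * ‖β‖ ^ (2 * M + 1) * ‖β‖ := by ring
      _ ≤ A * ‖β‖ ^ (2 * M + 1) * ((1 + τ) * β.re) := by gcongr
      _ = _ := by ring
  calc _ ≤ A * (1 + τ) * ‖β‖ ^ (2 * M + 1) * Real.pi := by
        have := Real.pi_pos
        gcongr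
    _ = _ := by ring

/-- The telescoped bound has the order of the last term retained. The expansion is therefore taken
one term further, and the extra term, itself of order `‖β‖ ^ (2N + 1)`, is moved into the error. -/
theorem norm_remainder_le (N : ℕ) {Y τ : ℝ} (hτ : Y * τ < Real.pi) (hτ0 : 0 ≤ τ) :
    ∃ D : ℝ, ∀ β y : ℂ, 0 < β.re → |β.im| ≤ τ * β.re →
      (∀ s : ℝ, 0 ≤ s → y + s * β ∈ rayRegion Y τ ∧ y + s * β ≠ 0) →
      ‖logQPoch β y - truncatedSeries N β y‖ ≤ D * ‖β‖ ^ (2 * N + 1) := by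
  obtain ⟨D, hD, hDle⟩ := norm_remainder_succ_le N hτ hτ0
  obtain ⟨C, hC, hCle⟩ := norm_polylogRegular_le (2 * N) hτ
  set b : ℂ := (bernoulli (2 * (N + 1)) : ℂ) / ((2 * (N + 1)).factorial : ℂ) with hb
  refine ⟨D + ‖b‖ * C, fun β y hβ hβτ h => ?_⟩
  have hw := h 0 le_rfl
  simp only [ofReal_zero, zero_mul, add_zero] at hw
  have hsplit : logQPoch β y - truncatedSeries N β y =
      (logQPoch β y - truncatedSeries (N + 1) β y) -
        b * β ^ (2 * N + 1) * polylogRegular (2 * N) y := by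
    rw [truncatedSeries, truncatedSeries, Finset.sum_Icc_succ_top (by omega)]
    have e1 : 2 * (N + 1) - 1 = 2 * N + 1 := by omega
    have e2 : 2 * (N + 1) - 2 = 2 * N := by omega
    rw [e1, e2, polylogRegular, pow_mul, neg_one_sq, one_pow, one_mul, hb]
    ring
  rw [hsplit]
  refine (norm_sub_le _ _).trans ?_
  rw [norm_mul, norm_mul, norm_pow]
  calc _ ≤ D * ‖β‖ ^ (2 * N + 1) + ‖b‖ * ‖β‖ ^ (2 * N + 1) * C := by
        gcongr
        · exact hDle β y hβ hβτ h
        · exact hCle y hw.1 hw.2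
    _ = _ := by ring

/-! ### Translating the conditions on `θ` and `Y` -/

/-- The tangent form covers `θ = 0` as well and supplies the slope `τ = |tan θ|` of the ray region.
-/
theorem mul_abs_tan_lt_pi {θ Y : ℝ} (hY : θ ≠ 0 → Y < Real.pi * |Real.cot θ|) :
    Y * |Real.tan θ| < Real.pi := by
  rcases eq_or_ne (Real.tan θ) 0 with ht | ht
  · simpa [ht] using Real.pi_pos
  · have hθ : θ ≠ 0 := by
      rintro rfl
      simp at ht
    have h := hY hθ
    have hcot : Real.cot θ = (Real.tan θ)⁻¹ := by
      rw [Real.cot_eq_cos_div_sin, Real.tan_eq_sin_div_cos, inv_div]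
    rw [hcot, abs_inv] at h
    have hpos := abs_pos.2 ht
    calc _ < Real.pi * |Real.tan θ|⁻¹ * |Real.tan θ| := by gcongr
      _ = _ := by field_simp

theorem re_pos_and_im_eq_of_arg {θ : ℝ} (hθ : |θ| < Real.pi / 2) {β : ℂ} (hβ : β ≠ 0)
    (harg : β.arg = θ) : 0 < β.re ∧ |β.im| = |Real.tan θ| * β.re := by
  have hre : 0 < β.re := by
    have := abs_arg_lt_pi_div_two_iff.1 (harg ▸ hθ)
    exact this.resolve_right hβ
  refine ⟨hre, ?_⟩
  rw [← harg, tan_arg, abs_div, abs_of_pos hre]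
  field_simp

end QPochAsymptotics

end

theorem mainTheorem3 (θ Y : ℝ) (hθ : |θ| < Real.pi / 2) (hY : 0 < Y)
    (hYθ : θ ≠ 0 → Y < Real.pi * |Real.cot θ|) :
    (∀ β : ℂ, β ≠ 0 → β.arg = θ →
      QPochAsymptotics.IsLogQPochBranch β (QPochAsymptotics.logQPoch β) ∧
      QPochAsymptotics.IsDilogExpBranch β (QPochAsymptotics.dilogExp β) ∧
      QPochAsymptotics.IsLogOneSubExpBranch β (QPochAsymptotics.logOneSubExp β)) ∧
    QPochAsymptotics.IsLogGammaBranch QPochAsymptotics.logGamma ∧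
    ∀ N : ℕ, ∃ D : ℝ, ∀ β y : ℂ, β ≠ 0 → β.arg = θ →
      |y.im| ≤ Real.pi → -Y ≤ y.re → (∀ t : ℝ, t ≤ 0 → y ≠ β * (t : ℂ)) →
      ‖QPochAsymptotics.logQPoch β y - QPochAsymptotics.truncatedSeries N β y‖
        ≤ D * ‖β‖ ^ (2 * N + 1) := by
  refine ⟨fun β hβ harg => ?_, QPochAsymptotics.isLogGammaBranch_logGamma, fun N => ?_⟩
  · have hre := (QPochAsymptotics.re_pos_and_im_eq_of_arg hθ hβ harg).1
    exact ⟨QPochAsymptotics.isLogQPochBranch_logQPoch hre,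
      QPochAsymptotics.isDilogExpBranch_dilogExp hre,
      QPochAsymptotics.isLogOneSubExpBranch_logOneSubExp hre⟩
  · obtain ⟨D, hD⟩ := QPochAsymptotics.norm_remainder_le N
      (QPochAsymptotics.mul_abs_tan_lt_pi hYθ) (abs_nonneg (Real.tan θ))
    refine ⟨D, fun β y hβ harg him hre hray => ?_⟩
    obtain ⟨h1, h2⟩ := QPochAsymptotics.re_pos_and_im_eq_of_arg hθ hβ harg
    refine hD β y h1 h2.le fun s hs =>
      ⟨QPochAsymptotics.add_mul_mem_rayRegion (abs_nonneg _) h1 h2.le him hre hs, fun h0 => ?_⟩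
    refine hray (-s) (by linarith) ?_
    push_cast
    linear_combination h0
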